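/- Let $\varphi=\frac{\sqrt5-1}{2}$. A Sturmian word is an infinite word $\mathbf x=x_1x_2\dots$ over $\{0,1\}$ having exactly $n+1$ distinct subwords of length $n$ for every $n\ge1$; it has slope $\varphi$ if for some real $\rho$ either $x_n=\lfloor (n+1)\varphi+\rho\rfloor-\lfloor n\varphi+\rho\rfloor$ for all $n\ge1$, or $x_n=\lceil (n+1)\varphi+\rho\rceil-\lceil n\varphi+\rho\rceil$ for all $n\ge1$. Let $r(n,\mathbf x)$ be the length of the shortest prefix of $\mathbf x$ in which some subword of length $n$ occurs twice, i.e. $r(n,\mathbf x)=\min\{m: x_j\cdots x_{j+n-1}=x_{m-n+1}\cdots x_m \text{ for some } 1\le j\le m-n\}$, and let $\mathrm{rep}(\mathbf x)=\liminf_{n\to\infty} r(n,\mathbf x)/n$. Put $M_0=0$, $M_1=1$, $M_{k+1}=M_kM_{k-1}$ for $k\ge 1$, and for $k\ge1$ let $\widetilde M_k$ be $M_kM_{k-1}$ with its last two letters removed. For $k\ge1$, $\mathbf x$ belongs, with the word $W$, at level $k$ to * case (i) if $W$ is a non-empty suffix of $M_k$ and $\mathbf x$ starts with $WM_k\widetilde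 M_k$; * case (ii) if $W$ is a non-empty suffix of $M_k$ and $\mathbf x$ starts with $WM_{k-1}M_k\widetilde M_k$; * case (iii) if $W$ is a non-empty suffix of $M_{k-1}$ and $\mathbf x$ starts with $WM_k\widetilde M_k$. The locating chain of $\mathbf x$ is the infinite sequence of the cases to which $\mathbf x$ belongs at levels $1,2,3,\dots$. Write $a$ for the block (i)(iii), $b$ for (ii), and $\overline w=www\cdots$. An $a$-chain (respectively $b$-chain) of length $m\ge1$ is an occurrence of $a^m$ (respectively $b^m$) in the locating chain that is immediately preceded and followed by $b$ (respectively $a$). For $d\ge1$ let $S_d$ be the set of $\mathbf x$ whose locating chain contains infinitely many $a$-chains of length at least $d$ or infinitely many $b$-chains of length at least $d$. **Theorem.** Let $\mathbf x$ be a Sturmian word of slope $\varphi$, and let $\mu_{\min}=1+\varphi^2$, $\mu_{\max}=1+\varphi$. Then for each $k\ge1$ there is exactly one pair consisting of a case and a word $W$ such that $\mathbf x$ belongs with $W$ to that case at level $k$ (so the locating chain is well defined), and 1. $\mu_{\min}\le \mathrm{rep}(\mathbf x)\le\mu_{\max}$; 2. $\mathrm{rep}(\mathbf x)=\mu_{\max}$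 if and only if the locating chain of $\mathbf x$ is $u\,\overline a$ or $v\,\overline b$ for some finite words $u,v$; 3. $\mathrm{rep}(\mathbf x)=\mu_{\min}$ if and only if $\mathbf x\in S_d$ for every $d\ge1$. -/

import Mathlib

namespace SturmianRep

/-- The finite word `w` occurs in the infinite word `s` at position `p` (positions start at `0`). -/
def OccursAt {α : Type} (s : ℕ → α) (w : List α) (p : ℕ) : Prop :=
  ∀ (i : ℕ) (h : i < w.length), s (p + i) = w[i]

/-! Infinite words over `{0, 1}` are functions `x : ℕ → Fin 2`;
the `n`-th letter in the usual numbering `x₁ x₂ x₃ …` is `x (n - 1)`. -/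

/-- Subword complexity: the number of distinct subwords of length `n`. -/
noncomputable def complexity (x : ℕ → Fin 2) (n : ℕ) : ℕ :=
  Set.ncard {w : List (Fin 2) | w.length = n ∧ ∃ p, OccursAt x w p}

/-- Sturmian words: `n + 1` distinct subwords of length `n`, for every `n ≥ 1`. -/
def IsSturmian (x : ℕ → Fin 2) : Prop :=
  ∀ n : ℕ, 1 ≤ n → complexity x n = n + 1

/-- `x` is a Sturmian word of slope `θ` (and some intercept `ρ`). The letter `x n` has number
`n + 1`, whence the shift by one in the two formulas. -/
def IsSturmianOfSlope (θ : ℝ) (x : ℕ → Fin 2) : Prop :=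
  IsSturmian x ∧ ∃ ρ : ℝ,
    (∀ n : ℕ, ((x n : ℕ) : ℤ) =
      ⌊(((n : ℝ) + 1) + 1) * θ + ρ⌋ - ⌊((n : ℝ) + 1) * θ + ρ⌋) ∨
    (∀ n : ℕ, ((x n : ℕ) : ℤ) =
      ⌈(((n : ℝ) + 1) + 1) * θ + ρ⌉ - ⌈((n : ℝ) + 1) * θ + ρ⌉)

/-- `r(n, x)`: the least length `m = k + n` of a prefix of `x` whose last `n` letters
(the subword at position `k`) already occur at an earlier position `j < k`. -/
noncomputable def r (n : ℕ) (x : ℕ → Fin 2) : ℕ :=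
  sInf {m : ℕ | ∃ j k : ℕ, j < k ∧ m = k + n ∧ ∀ i < n, x (j + i) = x (k + i)}

/-- The exponent of repetition `liminf r(n, x) / n`, taken in the extended reals. -/
noncomputable def rep (x : ℕ → Fin 2) : EReal :=
  Filter.liminf (fun n : ℕ => (((r n x : ℝ) / (n : ℝ) : ℝ) : EReal)) Filter.atTop

/-- The number `φ = [0; 1, 1, 1, …] = (√5 - 1) / 2`. -/
noncomputable def phi : ℝ := (Real.sqrt 5 - 1) / 2

/-- The words `M₀ = 0`, `M₁ = 1`, `M_{k+1} = M_k M_{k-1}` attached to the slope `φ`. -/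
def M : ℕ → List (Fin 2)
  | 0 => [0]
  | 1 => [1]
  | k + 2 => M (k + 1) ++ M k

/-- `M_k M_{k-1}` with its last two letters removed (used for `k ≥ 1`). -/
def Mtilde (k : ℕ) : List (Fin 2) := (M k ++ M (k - 1)).dropLast.dropLast

/-- The labels (i), (ii), (iii) of the three cases. -/
inductive LocCase
  | i
  | ii
  | iii

/-- `x` belongs to the given case at level `k ≥ 1`, with the word `W` in the role of `W_k`. -/
def InCaseWith (x : ℕ → Fin 2) (k : ℕ) : LocCase → List (Fin 2) → Prop
  | .i, W => W ≠ [] ∧ W <:+ M k ∧ OccursAt x (W ++ M k ++ Mtilde k) 0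
  | .ii, W => W ≠ [] ∧ W <:+ M k ∧ OccursAt x (W ++ M (k - 1) ++ M k ++ Mtilde k) 0
  | .iii, W => W ≠ [] ∧ W <:+ M (k - 1) ∧ OccursAt x (W ++ M k ++ Mtilde k) 0

/-- `x` belongs to the case `c` at level `k`. -/
def InCase (x : ℕ → Fin 2) (k : ℕ) (c : LocCase) : Prop :=
  ∃ W, InCaseWith x k c W

instance : Nonempty LocCase := ⟨.i⟩

/-- The locating chain of `x`: the sequence of the cases to which `x` belongs
at the levels `1, 2, 3, …` (the entry with index `n` belongs to level `n + 1`). -/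
noncomputable def locatingChain (x : ℕ → Fin 2) : Stream' LocCase :=
  fun n => Classical.epsilon (fun c => InCase x (n + 1) c)

/-- The block `a = (i)(iii)`. -/
def blockA : List LocCase := [.i, .iii]

/-- The block `b = (ii)`. -/
def blockB : List LocCase := [.ii]

/-- The power `w^d` of a finite word. -/
def wpow (w : List LocCase) (d : ℕ) : List LocCase := (List.replicate d w).flatten

theorem blockA_ne_nil : blockA ≠ [] := List.cons_ne_nil _ _

theorem blockB_ne_nil : blockB ≠ [] := List.cons_ne_nil _ _

/-- An `a`-chain of length `m` (a subword `a^m`, `m ≥ 1`, immediately preceded and followed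
by `b`); `p` is the position of the preceding `b`. -/
def IsAChain (s : Stream' LocCase) (m p : ℕ) : Prop :=
  1 ≤ m ∧ OccursAt s (blockB ++ wpow blockA m ++ blockB) p

/-- A `b`-chain of length `l` (a subword `b^l`, `l ≥ 1`, immediately preceded and followed
by `a`); `p` is the position of the preceding `a`. -/
def IsBChain (s : Stream' LocCase) (l p : ℕ) : Prop :=
  1 ≤ l ∧ OccursAt s (blockA ++ wpow blockB l ++ blockA) p

/-- The set `S_d`: infinitely many `a`-chains of length at least `d`,
or infinitely many `b`-chains of length at least `d`, in the locating chain. -/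
def S (d : ℕ) : Set (ℕ → Fin 2) :=
  {x | {p : ℕ | ∃ m, d ≤ m ∧ IsAChain (locatingChain x) m p}.Infinite ∨
       {p : ℕ | ∃ l, d ≤ l ∧ IsBChain (locatingChain x) l p}.Infinite}

/-- `μ_max = 1 + φ`. -/
noncomputable def muMax : ℝ := 1 + phi

/-- `μ_min = 1 + φ²`. -/
noncomputable def muMin : ℝ := 1 + phi ^ 2

end SturmianRep

namespace SturmianRep

open Filter

/-! The word extends to a two-sided word `X`, the same rotation coding read along all integers
(`IsSturmianOfSlope.exists_twoSided`). For every k, `X` is a concatenation of long blocks `M (k+1)`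
and short blocks `M k`, never with two short or three long ones in a row; joining each long block
with the short block after it, if there is one, gives the decomposition for k+1. Let w_k be the
first positive block boundary. The types of the two blocks meeting there, long-long, long-short or
short-long, are the cases (i), (ii), (iii) at level k+1, and W is the part of the earlier block from
the origin on, so |W| = w_k. From k to k+1, (i) forces (iii) and keeps w, (iii) keeps w and leads to
(i) or (ii), and (ii) leads to (i) or (ii) and replaces w_k by w_k + q_k. Hence, after a possible
initial (iii), the chain consists of blocks a and b.

Repeats are controlled by special words. A repeated pair moved to the left stops at the origin or at
a left special word, which starts at a boundary (`bdry_of_left_special`). A pair starting at the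
origin is extended to the right up to a mismatch, where `block_of_right_special` again yields
boundaries. So `Loc.repeat_cases` bounds r(n) - n from below once n ≥ q_{k+1} - 1, and explicit
repeats show that the bounds are sharp at the critical lengths; `ChainData` records all this
numerically.

The decisive ratios (r(n) - n)/n are about q_{k+1}/(w_k + q_{k+2}) at a block a starting at k, and
(w_k + q_k)/q_{k+2} at a block b. Both are at least about φ². An a-chain keeps w fixed while q
grows, so a long one makes the second ratio at the next b tend to φ²; a b-chain keeps q_{k+1} - w_k
fixed, so a long one makes the first ratio at the next a tend to φ². Bounded chains keep w_k away
from both extremes (`ChainData.bounds_of_short`), hence the ratios away from φ². If the chain is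
eventually periodic with period a or b, then w_k or q_{k+1} - w_k is eventually constant and the
limit is φ; if a is followed by b infinitely often, one of the two ratios is at most 11/20 < φ each
time (`rep_lt_muMax`). -/

/-- The length of `M k`. -/
def q (k : ℕ) : ℤ := (Nat.fib (k + 1) : ℤ)

theorem q_zero : q 0 = 1 := rfl

theorem q_one : q 1 = 1 := rfl

theorem q_add_two (k : ℕ) : q (k + 2) = q (k + 1) + q k := by
  unfold q; rw [Nat.fib_add_two (n := k + 1)]; push_cast; ring

theorem q_pos (k : ℕ) : 1 ≤ q k := by
  have : 0 < Nat.fib (k + 1) := Nat.fib_pos.2 k.succ_pos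
  unfold q; omega

theorem q_le_succ (k : ℕ) : q k ≤ q (k + 1) := by
  have := Nat.fib_le_fib_succ (n := k + 1)
  unfold q; omega

/-! ### Hierarchy of block decompositions of a two-sided word -/

/-- The lengths of the long (`true`) and short (`false`) blocks of level `k + 1`. -/
def len (k : ℕ) : Bool → ℤ
  | true => q (k + 1)
  | false => q k

theorem len_pos (k : ℕ) (c : Bool) : 1 ≤ len k c := by
  cases c <;> exact q_pos _

theorem le_len (k : ℕ) (c : Bool) : q k ≤ len k c := by
  cases c
  · exact le_rfl
  · exact q_le_succ k

/-- `Block X k c p`: in the decomposition of the two-sided word `X` into blocks `M (k + 1)`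
(`c = true`) and `M k` (`c = false`), a block of type `c` starts at position `p`. -/
def Block (X : ℤ → Fin 2) : ℕ → Bool → ℤ → Prop
  | 0, true, p => X p = 1
  | 0, false, p => X p = 0
  | k + 1, true, p => Block X k true p ∧ Block X k false (p + q (k + 1))
  | k + 1, false, p => Block X k true p ∧ Block X k true (p + q (k + 1))

/-- A block of level `k + 1` starts at `p`. -/
def Bdry (X : ℤ → Fin 2) (k : ℕ) (p : ℤ) : Prop := ∃ c, Block X k c p

/-- At no level are there three consecutive long blocks. -/
def NoTriple (X : ℤ → Fin 2) : Prop :=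
  ∀ k p, Block X k true p → Block X k true (p + q (k + 1)) →
    ¬ Block X k true (p + q (k + 1) + q (k + 1))

/-- At level one there are no two consecutive short blocks. -/
def NoDoubleZero (X : ℤ → Fin 2) : Prop := ∀ p, X p = 0 → X (p + 1) = 1

variable {X : ℤ → Fin 2}

theorem Block.large {k : ℕ} {c : Bool} {p : ℤ} (h : Block X (k + 1) c p) : Block X k true p := by
  cases c <;> exact h.1

theorem Bdry.large {k : ℕ} {p : ℤ} (h : Bdry X (k + 1) p) : Block X k true p :=
  h.elim fun _ hc => hc.large

theorem Block.bdry {k : ℕ} {c : Bool} {p : ℤ} (h : Block X k c p) : Bdry X k p := ⟨c, h⟩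

theorem bdry_zero (p : ℤ) : Bdry X 0 p := by
  have : X p = 0 ∨ X p = 1 := by
    generalize X p = a
    fin_cases a <;> simp
  rcases this with h | h
  · exact ⟨false, h⟩
  · exact ⟨true, h⟩

theorem Block.unique : ∀ {k : ℕ} {c c' : Bool} {p : ℤ}, Block X k c p → Block X k c' p → c = c' := by
  intro k
  induction k with
  | zero =>
    intro c c' p h h'
    cases c <;> cases c' <;> simp_all [Block]
  | succ k ih =>
    intro c c' p h h'
    cases c <;> cases c'
    · rfl
    · exact absurd (ih h.2 h'.2) (by simp)
    · exact absurd (ih h.2 h'.2) (by simp)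
    · rfl

/-- Two consecutive short blocks would be three consecutive long blocks one level below; at the
bottom they would be two consecutive zeros. -/
theorem Block.after_small (h0 : NoDoubleZero X) (hX : NoTriple X) {k : ℕ} {p : ℤ}
    (h : Block X k false p) (hb : Bdry X k (p + q k)) : Block X k true (p + q k) := by
  obtain ⟨c, hc⟩ := hb
  cases c with
  | true => exact hc
  | false =>
    exfalso
    cases k with
    | zero =>
      have := h0 p h
      have h2 : X (p + 1) = 0 := hc
      simp_all
    | succ k => exact hX k p h.1 h.2 hc.2

theorem Block.next (h0 : NoDoubleZero X) (hX : NoTriple X) : ∀ {k : ℕ} {c : Bool} {p : ℤ},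
    Block X k c p → Bdry X k (p + len k c) := by
  intro k
  induction k with
  | zero => intro c p _; exact bdry_zero _
  | succ k ih =>
    intro c p h
    have key : ∀ r, Block X k true r → Bdry X (k + 1) r := by
      intro r hr
      obtain ⟨c, hc⟩ := ih hr
      cases c
      · exact ⟨true, hr, hc⟩
      · exact ⟨false, hr, hc⟩
    cases c with
    | true =>
      have h2 := h.2.after_small h0 hX (ih h.2)
      have := key _ h2
      rw [show p + len (k + 1) true = p + q (k + 1) + q k by
        simp only [len]; rw [q_add_two]; ring]
      exact this
    | false => exact key _ h.2

theorem Block.large_bdry (h0 : NoDoubleZero X) (hX : NoTriple X) {k : ℕ} {p : ℤ}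
    (h : Block X k true p) : Bdry X (k + 1) p := by
  obtain ⟨c, hc⟩ := h.next h0 hX
  cases c
  · exact ⟨true, h, hc⟩
  · exact ⟨false, h, hc⟩

theorem Block.small_next (h0 : NoDoubleZero X) (hX : NoTriple X) {k : ℕ} {p : ℤ}
    (h : Block X k false p) : Block X k true (p + q k) :=
  h.after_small h0 hX (h.next h0 hX)

theorem Bdry.prev (h0 : NoDoubleZero X) (hX : NoTriple X) : ∀ {k : ℕ} {p : ℤ},
    Bdry X k p → ∃ c, Block X k c (p - len k c) := by
  intro k
  induction k with
  | zero =>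
    intro p _
    obtain ⟨c, hc⟩ := bdry_zero (X := X) (p - 1)
    refine ⟨c, ?_⟩
    cases c <;> exact hc
  | succ k ih =>
    intro p h
    have hp := h.large
    obtain ⟨c, hc⟩ := ih hp.bdry
    cases c with
    | true =>
      refine ⟨false, hc, ?_⟩
      have : p - len (k + 1) false + q (k + 1) = p := by simp only [len]; ring
      rw [this]; exact hp
    | false =>
      obtain ⟨c', hc'⟩ := ih hc.bdry
      cases c' with
      | true =>
        refine ⟨true, ?_⟩
        have e : p - len (k + 1) true = p - len k false - len k true := by
          simp only [len]; rw [q_add_two]; ring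
        rw [e]
        refine ⟨hc', ?_⟩
        have : p - len k false - len k true + q (k + 1) = p - len k false := by
          simp only [len]; ring
        rw [this]; exact hc
      | false =>
        have := hc'.small_next h0 hX
        have e : p - len k false - len k false + q k = p - len k false := by
          simp only [len]; ring
        rw [e] at this
        exact absurd (this.unique hc) (by simp)

theorem Block.prev_of_small (h0 : NoDoubleZero X) (hX : NoTriple X) {k : ℕ} {p : ℤ}
    (h : Block X k false p) : Block X k true (p - q (k + 1)) := by
  obtain ⟨c, hc⟩ := h.bdry.prev h0 hX
  cases c with
  | true => exact hc
  | false =>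
    have := hc.small_next h0 hX
    rw [show p - len k false + q k = p by simp only [len]; ring] at this
    exact absurd (this.unique h) (by simp)

/-- A boundary one level up is the start of a long block one level down, and the only lower boundary
inside `M (k+1) ++ M k` starts a short block. -/
theorem Block.gap : ∀ {k : ℕ} {c : Bool} {p s : ℤ},
    Block X k c p → p < s → s < p + len k c → ¬ Bdry X k s := by
  intro k
  induction k with
  | zero =>
    intro c p s _ h1 h2
    have : len 0 c = 1 := by cases c <;> rfl
    omega
  | succ k ih =>
    intro c p s h h1 h2 hs
    have hs' := hs.large
    cases c with
    | false => exact ih h.1 h1 h2 hs'.bdry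
    | true =>
      have e : len (k + 1) true = q (k + 1) + q k := q_add_two k
      rw [e] at h2
      rcases lt_trichotomy s (p + q (k + 1)) with h3 | h3 | h3
      · exact ih h.1 h1 h3 hs'.bdry
      · rw [h3] at hs'
        exact absurd (hs'.unique h.2) (by simp)
      · exact ih h.2 h3 (by simp only [len]; omega) hs'.bdry

theorem Block.le_of_lt {k : ℕ} {c : Bool} {p s : ℤ}
    (h : Block X k c p) (h1 : p < s) (hs : Bdry X k s) : p + len k c ≤ s := by
  by_contra! h2
  exact h.gap h1 h2 hs

/-- The last letter of a block. -/
def lastLetter : ℕ → Bool → Fin 2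
  | 0, true => 1
  | 0, false => 0
  | k + 1, true => lastLetter k false
  | k + 1, false => lastLetter k true

theorem lastLetter_inj : ∀ {k : ℕ} {c c' : Bool}, lastLetter k c = lastLetter k c' → c = c' := by
  intro k
  induction k with
  | zero => intro c c'; cases c <;> cases c' <;> simp [lastLetter]
  | succ k ih =>
    intro c c' h
    cases c <;> cases c' <;> simp only [lastLetter] at h <;> first | rfl | exact absurd (ih h) (by simp)

theorem Block.last : ∀ {k : ℕ} {c : Bool} {p : ℤ},
    Block X k c p → X (p + len k c - 1) = lastLetter k c := by
  intro k
  induction k with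
  | zero =>
    intro c p h
    cases c
    · rw [show p + len 0 false - 1 = p by simp [len, q]]; exact h
    · rw [show p + len 0 true - 1 = p by simp [len, q]]; exact h
  | succ k ih =>
    intro c p h
    cases c with
    | false => exact ih h.1
    | true =>
      have := ih h.2
      rw [show p + len (k + 1) true - 1 = p + q (k + 1) + len k false - 1 by
        simp only [len]; rw [q_add_two]; ring]
      exact this

/-- The two block types of a level end in different letters, so the single letter before a boundary
tells which block ends there. -/
theorem Bdry.prev_of_last (h0 : NoDoubleZero X) (hX : NoTriple X) {k : ℕ} {c : Bool} {p : ℤ}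
    (h : Bdry X k p) (hl : X (p - 1) = lastLetter k c) : Block X k c (p - len k c) := by
  obtain ⟨c', hc'⟩ := h.prev h0 hX
  have := hc'.last
  rw [show p - len k c' + len k c' - 1 = p - 1 by ring, hl] at this
  rw [lastLetter_inj this]; exact hc'

theorem Block.prev_eq (h0 : NoDoubleZero X) (hX : NoTriple X) {k : ℕ} {c : Bool} {p p' : ℤ}
    (hc : Block X k c (p - len k c)) (h' : Bdry X k p') (hl : X (p - 1) = X (p' - 1)) :
    Block X k c (p' - len k c) := by
  refine h'.prev_of_last h0 hX ?_
  have := hc.last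
  rw [← hl, ← this]; congr 1; ring

/-! ### Words read from boundaries, recognizability, special words -/

/-- Blocks of the same type are equal words. -/
theorem Block.agree : ∀ {k : ℕ} {c : Bool} {p p' : ℤ}, Block X k c p → Block X k c p' →
    ∀ i : ℤ, 0 ≤ i → i < len k c → X (p + i) = X (p' + i) := by
  intro k
  induction k with
  | zero =>
    intro c p p' h h' i hi hi'
    have : len 0 c = 1 := by cases c <;> rfl
    obtain rfl : i = 0 := by omega
    cases c <;> simp only [Block] at h h' <;> simp [h, h']
  | succ k ih =>
    intro c p p' h h' i hi hi'
    cases c with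
    | false => exact ih h.1 h'.1 i hi hi'
    | true =>
      by_cases hlt : i < q (k + 1)
      · exact ih h.1 h'.1 i hi hlt
      · have e : len (k + 1) true = q (k + 1) + q k := q_add_two k
        have := ih h.2 h'.2 (i - q (k + 1)) (by omega) (by simp only [len]; omega)
        rw [show p + q (k + 1) + (i - q (k + 1)) = p + i by ring,
          show p' + q (k + 1) + (i - q (k + 1)) = p' + i by ring] at this
        exact this

/-- All boundaries of level `k + 1` are followed by the same word of length `q (k + 2) - 2`. -/
theorem Bdry.agree (h0 : NoDoubleZero X) (hX : NoTriple X) : ∀ {k : ℕ} {p p' : ℤ},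
    Bdry X k p → Bdry X k p' →
    ∀ i : ℤ, 0 ≤ i → i < q (k + 2) - 2 → X (p + i) = X (p' + i) := by
  intro k
  induction k with
  | zero =>
    intro p p' _ _ i hi hi'
    have : q (0 + 2) = 2 := rfl
    omega
  | succ k ih =>
    intro p p' h h' i hi hi'
    by_cases hlt : i < q (k + 1)
    · exact h.large.agree h'.large i hi hlt
    · have e : q (k + 1 + 2) = q (k + 2) + q (k + 1) := q_add_two (k + 1)
      have := ih (h.large.next h0 hX) (h'.large.next h0 hX) (i - q (k + 1)) (by omega) (by omega)
      simp only [len] at this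
      rw [show p + q (k + 1) + (i - q (k + 1)) = p + i by ring,
        show p' + q (k + 1) + (i - q (k + 1)) = p' + i by ring] at this
      exact this

/-- The words read from two blocks of different type differ at place `q (k + 2) - 2`. -/
theorem Block.ne_of_ne : ∀ {k : ℕ} {p p' : ℤ},
    Block X k true p → Block X k false p' → X (p + (q (k + 2) - 2)) ≠ X (p' + (q (k + 2) - 2)) := by
  intro k
  induction k with
  | zero =>
    intro p p' h h'
    have e : q (0 + 2) - 2 = 0 := rfl
    simp only [Block] at h h'
    simp [e, h, h']
  | succ k ih =>
    intro p p' h h'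
    -- Both blocks begin with `M (k+1)`; the blocks after it have opposite types, with the roles of
    -- long and short exchanged.
    have := ih h'.2 h.2
    have e : q (k + 1 + 2) = q (k + 2) + q (k + 1) := q_add_two (k + 1)
    rw [show p + (q (k + 1 + 2) - 2) = p + q (k + 1) + (q (k + 2) - 2) by omega,
      show p' + (q (k + 1 + 2) - 2) = p' + q (k + 1) + (q (k + 2) - 2) by omega]
    exact this.symm

/-- Recognizability: the common word of length `q (k + 2) - 2` occurs only at boundaries. -/
theorem Bdry.of_agree (h0 : NoDoubleZero X) (hX : NoTriple X) : ∀ {k : ℕ} {p p' : ℤ},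
    Bdry X k p' → (∀ i : ℤ, 0 ≤ i → i < q (k + 2) - 2 → X (p + i) = X (p' + i)) →
    Bdry X k p := by
  intro k
  induction k with
  | zero => intro p p' _ _; exact bdry_zero p
  | succ k ih =>
    intro p p' h' hag
    have e : q (k + 1 + 2) = q (k + 2) + q (k + 1) := q_add_two (k + 1)
    have hq1 := q_pos (k + 1)
    have hb : Bdry X k p := ih h'.large.bdry fun i hi hi' => hag i hi (by omega)
    have hb2 : Bdry X k (p + q (k + 1)) := by
      refine ih (h'.large.next h0 hX) fun i hi hi' => ?_
      have := hag (q (k + 1) + i) (by omega) (by omega)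
      simp only [len]
      rw [← add_assoc, ← add_assoc] at this
      exact this
    suffices Block X k true p from this.large_bdry h0 hX
    obtain ⟨c, hc⟩ := hb
    cases c with
    | true => exact hc
    | false =>
      exfalso
      -- A short block at `p` would put the boundary `p + q (k+1)` strictly inside the long block
      -- after it. At the bottom `q 1 = q 0` and this fails, so the first letter is compared
      -- instead.
      cases k with
      | zero =>
        have h1 := hag 0 le_rfl (by decide)
        have h2 : X p' = 1 := h'.large
        have h3 : X p = 0 := hc
        simp [h2, h3] at h1
      | succ k =>
        have h1 := hc.small_next h0 hX
        have e1 : q (k + 1 + 1) = q (k + 1) + q k := q_add_two k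
        have := q_pos k
        have := q_pos (k + 1)
        exact h1.gap (s := p + q (k + 1 + 1)) (by omega) (by simp only [len]; omega) hb2

/-- A left special word of length at least `q (k + 1) - 1` starts at boundaries of level
`k + 1`. -/
theorem bdry_of_left_special (h0 : NoDoubleZero X) (hX : NoTriple X) : ∀ {k : ℕ} {p p' : ℤ},
    X (p - 1) ≠ X (p' - 1) →
    (∀ i : ℤ, 0 ≤ i → i < q (k + 1) - 1 → X (p + i) = X (p' + i)) →
    Bdry X k p ∧ Bdry X k p' := by
  intro k
  induction k with
  | zero => intro p p' _ _; exact ⟨bdry_zero p, bdry_zero p'⟩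
  | succ k ih =>
    intro p p' hne hag
    have e : q (k + 1 + 1) = q (k + 1) + q k := q_add_two k
    have e2 : q (k + 1 + 1) = q (k + 2) := rfl
    have hq := q_pos k
    have hq2 := q_pos (k + 1)
    obtain ⟨⟨c, hc⟩, ⟨c', hc'⟩⟩ := ih hne fun i hi hi' => hag i hi (by omega)
    have hag2 := hag (q (k + 2) - 2) (by omega) (by omega)
    -- The agreement reaches the place where blocks of different types must differ. Both blocks
    -- cannot be short, since then the same long block would precede both and the letters on the
    -- left would coincide.
    have hcc : c = c' := by
      cases c <;> cases c'
      · rfl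
      · exact absurd hag2.symm (hc'.ne_of_ne hc)
      · exact absurd hag2 (hc.ne_of_ne hc')
      · rfl
    subst hcc
    cases c with
    | true => exact ⟨hc.large_bdry h0 hX, hc'.large_bdry h0 hX⟩
    | false =>
      exfalso
      have h1 := (hc.prev_of_small h0 hX).last
      have h2 := (hc'.prev_of_small h0 hX).last
      simp only [len, sub_add_cancel] at h1 h2
      exact hne (h1.trans h2.symm)

/-- A right special word of length at least `q (k + 2) - 2` ends with the common word of
length `q (k + 2) - 2` read from boundaries of level `k + 1`. -/
theorem block_of_right_special (h0 : NoDoubleZero X) (hX : NoTriple X) : ∀ {k : ℕ} {s s' : ℤ},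
    X s ≠ X s' → (∀ i : ℤ, 1 ≤ i → i ≤ q (k + 1) - 1 → X (s - i) = X (s' - i)) →
    ∃ c, Block X k c (s - (q (k + 2) - 2)) ∧ Block X k (!c) (s' - (q (k + 2) - 2)) := by
  intro k
  induction k with
  | zero =>
    intro s s' hne _
    rw [show s - (q (0 + 2) - 2) = s from sub_zero s, show s' - (q (0 + 2) - 2) = s' from sub_zero s']
    obtain ⟨c, hc⟩ := bdry_zero (X := X) s
    obtain ⟨c', hc'⟩ := bdry_zero (X := X) s'
    refine ⟨c, hc, ?_⟩
    cases c <;> cases c' <;> first | exact hc' | (simp only [Block] at hc hc'; simp_all)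
  | succ k ih =>
    intro s s' hne hag
    have e : q (k + 1 + 1) = q (k + 1) + q k := q_add_two k
    have e2 : q (k + 1 + 1) = q (k + 2) := rfl
    have e3 : q (k + 1 + 2) = q (k + 2) + q (k + 1) := q_add_two (k + 1)
    have hq := q_pos k
    have hq2 := q_pos (k + 1)
    obtain ⟨c, hc, hc'⟩ := ih hne fun i hi hi' => hag i hi (by omega)
    have hl := hag (q (k + 2) - 1) (by omega) (by omega)
    rw [show s - (q (k + 2) - 1) = s - (q (k + 2) - 2) - 1 by ring,
      show s' - (q (k + 2) - 1) = s' - (q (k + 2) - 2) - 1 by ring] at hl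
    rw [show s - (q (k + 1 + 2) - 2) = s - (q (k + 2) - 2) - q (k + 1) by omega,
      show s' - (q (k + 1 + 2) - 2) = s' - (q (k + 2) - 2) - q (k + 1) by omega]
    generalize s - (q (k + 2) - 2) = p at *
    generalize s' - (q (k + 2) - 2) = p' at *
    -- One of the two blocks is short, so a long block precedes it; the equal letters on the left
    -- put a long block before the other one too. Adding these long blocks exchanges the types one
    -- level up.
    cases c with
    | true =>
      have h1 := hc'.prev_of_small h0 hX
      have h2 := h1.prev_eq (c := true) h0 hX hc.bdry hl.symm
      exact ⟨false, ⟨h2, by rw [sub_add_cancel]; exact hc⟩, ⟨h1, by rw [sub_add_cancel]; exact hc'⟩⟩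
    | false =>
      have h1 := hc.prev_of_small h0 hX
      have h2 := h1.prev_eq (c := true) h0 hX hc'.bdry hl
      exact ⟨true, ⟨h1, by rw [sub_add_cancel]; exact hc⟩, ⟨h2, by rw [sub_add_cancel]; exact hc'⟩⟩

/-! ### Renormalization of the rotation and the two-sided extension -/

theorem phi_sq : phi ^ 2 = 1 - phi := by
  have h : Real.sqrt 5 ^ 2 = 5 := Real.sq_sqrt (by norm_num)
  unfold phi
  nlinarith

theorem half_lt_phi : 3 / 5 < phi := by
  have h : (11 / 5 : ℝ) < Real.sqrt 5 := Real.lt_sqrt_of_sq_lt (by norm_num)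
  unfold phi
  linarith

theorem phi_lt : phi < 5 / 8 := by
  have h : Real.sqrt 5 < (9 / 4 : ℝ) := by
    rw [Real.sqrt_lt' (by norm_num)]; norm_num
  unfold phi
  linarith

/-- The blocks of level `k + 1` are located by a real coordinate `t`. -/
structure Coding (X : ℤ → Fin 2) (k : ℕ) (t : ℤ → ℝ) : Prop where
  long : ∀ p, Block X k true p → 0 ≤ t p ∧ t p ≤ phi ^ (k + 1) ∧
    t (p + q (k + 1)) = t p - phi ^ (k + 2)
  short : ∀ p, Block X k false p → -phi ^ (k + 2) ≤ t p ∧ t p ≤ 0 ∧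
    t (p + q k) = t p + phi ^ (k + 1)

/-- Inducing the two-interval exchange on the interval of long blocks gives the same exchange scaled
by φ and reflected. The intervals in `Coding` are closed at both ends, so that floor and ceiling
codings are both covered. -/
theorem Coding.succ {k : ℕ} {t : ℤ → ℝ} (h : Coding X k t) :
    Coding X (k + 1) fun p => phi ^ (k + 2) - t p := by
  have e : phi ^ (k + 3) = phi ^ (k + 1) - phi ^ (k + 2) := by
    calc phi ^ (k + 3) = phi ^ (k + 1) * phi ^ 2 := by ring
      _ = _ := by rw [phi_sq]; ring
  constructor
  · rintro p ⟨h1, h2⟩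
    obtain ⟨a1, a2, a3⟩ := h.long _ h1
    obtain ⟨b1, b2, b3⟩ := h.short _ h2
    rw [show p + q (k + 1 + 1) = p + q (k + 1) + q k by
      rw [show k + 1 + 1 = k + 2 from rfl, q_add_two]; ring]
    simp only [show k + 1 + 1 = k + 2 from rfl, show k + 1 + 2 = k + 3 from rfl]
    refine ⟨?_, ?_, ?_⟩ <;> linarith
  · rintro p ⟨h1, h2⟩
    obtain ⟨a1, a2, a3⟩ := h.long _ h1
    obtain ⟨b1, b2, b3⟩ := h.long _ h2
    simp only [show k + 1 + 1 = k + 2 from rfl, show k + 1 + 2 = k + 3 from rfl]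
    refine ⟨?_, ?_, ?_⟩ <;> linarith

/-- Three long blocks in a row need two steps of size φ^(k+2) inside an interval of length φ^(k+1),
impossible since 2φ > 1. -/
theorem Coding.noTriple {t : ℤ → ℝ} (h : Coding X 0 t) : NoTriple X := by
  have H : ∀ k, ∃ t, Coding X k t := by
    intro k
    induction k with
    | zero => exact ⟨t, h⟩
    | succ k ih => obtain ⟨t, ht⟩ := ih; exact ⟨_, ht.succ⟩
  intro k p h1 h2 h3
  obtain ⟨t, ht⟩ := H k
  obtain ⟨a1, a2, a3⟩ := ht.long _ h1
  obtain ⟨b1, b2, b3⟩ := ht.long _ h2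
  obtain ⟨c1, c2, c3⟩ := ht.long _ h3
  have h4 : phi ^ (k + 2) = phi ^ (k + 1) * phi := pow_succ _ _
  have h5 : 0 < phi ^ (k + 1) := pow_pos (by linarith [half_lt_phi]) _
  nlinarith [half_lt_phi]

theorem Coding.noDoubleZero {t : ℤ → ℝ} (h : Coding X 0 t) : NoDoubleZero X := by
  intro p hp
  obtain ⟨c, hc⟩ := bdry_zero (X := X) (p + 1)
  cases c with
  | true => exact hc
  | false =>
    exfalso
    obtain ⟨a1, a2, a3⟩ := h.short p hp
    obtain ⟨b1, b2, b3⟩ := h.short _ hc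
    simp only [q_zero, zero_add, pow_one] at a1 a2 a3 b1 b2
    linarith [phi_sq, half_lt_phi]

theorem exists_twoSided_of_floor {x : ℕ → Fin 2} {ρ : ℝ} (h : ∀ n : ℕ, ((x n : ℕ) : ℤ) =
      ⌊(((n : ℝ) + 1) + 1) * phi + ρ⌋ - ⌊((n : ℝ) + 1) * phi + ρ⌋) :
    ∃ X : ℤ → Fin 2, NoDoubleZero X ∧ NoTriple X ∧ ∀ n : ℕ, X n = x n := by
  classical
  set y : ℤ → ℝ := fun p => ((p : ℝ) + 1) * phi + ρ with hy
  have ystep : ∀ p : ℤ, y (p + 1) = y p + phi := fun p => by simp only [hy]; push_cast; ring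
  set t : ℤ → ℝ := fun p => Int.fract (y p) - phi ^ 2 with ht
  have h1 : ∀ p, phi ^ 2 ≤ Int.fract (y p) → ⌊y (p + 1)⌋ = ⌊y p⌋ + 1 := by
    intro p hp
    rw [Int.floor_eq_iff, ystep]
    have := Int.floor_add_fract (y p)
    have := Int.fract_lt_one (y p)
    push_cast
    constructor <;> linarith [phi_sq, phi_lt]
  have h2 : ∀ p, Int.fract (y p) < phi ^ 2 → ⌊y (p + 1)⌋ = ⌊y p⌋ := by
    intro p hp
    rw [Int.floor_eq_iff, ystep]
    have := Int.floor_add_fract (y p)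
    have := Int.fract_nonneg (y p)
    constructor <;> linarith [phi_sq, half_lt_phi]
  set X : ℤ → Fin 2 := fun p => if phi ^ 2 ≤ Int.fract (y p) then 1 else 0 with hXdef
  have hc : Coding X 0 t := by
    constructor
    · intro p hp
      have hp' : phi ^ 2 ≤ Int.fract (y p) := by
        by_contra hn
        simp only [Block, hXdef, if_neg hn] at hp
        exact absurd hp (by decide)
      have e := h1 p hp'
      have f1 : Int.fract (y (p + 1)) = Int.fract (y p) + phi - 1 := by
        simp only [Int.fract, e]; rw [ystep]; push_cast; ring
      have := Int.fract_lt_one (y p)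
      simp only [ht, q_one, zero_add, pow_one, f1]
      refine ⟨?_, ?_, ?_⟩ <;> linarith [phi_sq]
    · intro p hp
      have hp' : Int.fract (y p) < phi ^ 2 := by
        by_contra! hn
        simp only [Block, hXdef, if_pos hn] at hp
        exact absurd hp (by decide)
      have e := h2 p hp'
      have f1 : Int.fract (y (p + 1)) = Int.fract (y p) + phi := by
        simp only [Int.fract, e]; rw [ystep]; ring
      have := Int.fract_nonneg (y p)
      simp only [ht, q_zero, zero_add, pow_one, f1]
      refine ⟨?_, ?_, ?_⟩ <;> linarith [phi_sq]
  refine ⟨X, hc.noDoubleZero, hc.noTriple, fun n => ?_⟩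
  have hn := h n
  have e1 : (((n : ℝ) + 1) + 1) * phi + ρ = y ((n : ℤ) + 1) := by simp only [hy]; push_cast; ring
  have e2 : ((n : ℝ) + 1) * phi + ρ = y (n : ℤ) := by simp [hy]
  rw [e1, e2] at hn
  by_cases hp : phi ^ 2 ≤ Int.fract (y n)
  · rw [h1 _ hp] at hn
    simp only [hXdef, if_pos hp]
    ext; simp only [Fin.val_one]; omega
  · rw [h2 _ (not_le.1 hp)] at hn
    simp only [hXdef, if_neg hp]
    ext; simp only [Fin.val_zero]; omega

theorem exists_twoSided_of_ceil {x : ℕ → Fin 2} {ρ : ℝ} (h : ∀ n : ℕ, ((x n : ℕ) : ℤ) =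
      ⌈(((n : ℝ) + 1) + 1) * phi + ρ⌉ - ⌈((n : ℝ) + 1) * phi + ρ⌉) :
    ∃ X : ℤ → Fin 2, NoDoubleZero X ∧ NoTriple X ∧ ∀ n : ℕ, X n = x n := by
  classical
  set y : ℤ → ℝ := fun p => ((p : ℝ) + 1) * phi + ρ with hy
  have ystep : ∀ p : ℤ, y (p + 1) = y p + phi := fun p => by simp only [hy]; push_cast; ring
  set t : ℤ → ℝ := fun p => phi - (⌈y p⌉ - y p) with ht
  have h1 : ∀ p, ⌈y p⌉ - y p < phi → ⌈y (p + 1)⌉ = ⌈y p⌉ + 1 := by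
    intro p hp
    rw [Int.ceil_eq_iff, ystep]
    have := Int.le_ceil (y p)
    push_cast
    constructor <;> linarith [phi_lt]
  have h2 : ∀ p, phi ≤ ⌈y p⌉ - y p → ⌈y (p + 1)⌉ = ⌈y p⌉ := by
    intro p hp
    rw [Int.ceil_eq_iff, ystep]
    have := Int.ceil_lt_add_one (y p)
    constructor <;> linarith [half_lt_phi]
  set X : ℤ → Fin 2 := fun p => if ⌈y p⌉ - y p < phi then 1 else 0 with hXdef
  have hc : Coding X 0 t := by
    constructor
    · intro p hp
      have hp' : ⌈y p⌉ - y p < phi := by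
        by_contra hn
        simp only [Block, hXdef, if_neg hn] at hp
        exact absurd hp (by decide)
      have e := h1 p hp'
      have := Int.le_ceil (y p)
      simp only [ht, q_one, zero_add, pow_one, e]
      rw [ystep]
      push_cast
      refine ⟨?_, ?_, ?_⟩ <;> linarith [phi_sq]
    · intro p hp
      have hp' : phi ≤ ⌈y p⌉ - y p := by
        by_contra! hn
        simp only [Block, hXdef, if_pos hn] at hp
        exact absurd hp (by decide)
      have e := h2 p hp'
      have := Int.ceil_lt_add_one (y p)
      simp only [ht, q_zero, zero_add, pow_one, e]
      rw [ystep]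
      refine ⟨?_, ?_, ?_⟩ <;> linarith [phi_sq]
  refine ⟨X, hc.noDoubleZero, hc.noTriple, fun n => ?_⟩
  have hn := h n
  have e1 : (((n : ℝ) + 1) + 1) * phi + ρ = y ((n : ℤ) + 1) := by simp only [hy]; push_cast; ring
  have e2 : ((n : ℝ) + 1) * phi + ρ = y (n : ℤ) := by simp [hy]
  rw [e1, e2] at hn
  by_cases hp : ⌈y n⌉ - y n < phi
  · rw [h1 _ hp] at hn
    simp only [hXdef, if_pos hp]
    ext; simp only [Fin.val_one]; omega
  · rw [h2 _ (not_lt.1 hp)] at hn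
    simp only [hXdef, if_neg hp]
    ext; simp only [Fin.val_zero]; omega

theorem IsSturmianOfSlope.exists_twoSided {x : ℕ → Fin 2} (hx : IsSturmianOfSlope phi x) :
    ∃ X : ℤ → Fin 2, NoDoubleZero X ∧ NoTriple X ∧ ∀ n : ℕ, X n = x n := by
  obtain ⟨-, ρ, h | h⟩ := hx
  · exact exists_twoSided_of_floor h
  · exact exists_twoSided_of_ceil h

theorem natCast_le_q (k : ℕ) : (k : ℤ) ≤ q k := by
  have := Nat.le_fib_add_one (k + 1)
  unfold q; omega

/-! ### The first boundary after the origin and its evolution with the level -/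

/-- At level `k + 1`, the first boundary after position `0` is `w`; it ends a block of type `c`
and starts a block of type `c'`. -/
structure Loc (X : ℤ → Fin 2) (k : ℕ) (c c' : Bool) (w : ℤ) : Prop where
  prev : Block X k c (w - len k c)
  next : Block X k c' w
  pos : 1 ≤ w
  le : w ≤ len k c

theorem Loc.not_small (h0 : NoDoubleZero X) (hX : NoTriple X) {k : ℕ} {w : ℤ} :
    ¬ Loc X k false false w := by
  intro h
  have := h.prev.small_next h0 hX
  rw [show w - len k false + q k = w by simp only [len]; ring] at this
  exact absurd (this.unique h.next) (by simp)

/-- A long block followed by a long one is a short block one level up, so `w` stays a boundary. -/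
theorem Loc.succ_i (h0 : NoDoubleZero X) (hX : NoTriple X) {k : ℕ} {w : ℤ}
    (h : Loc X k true true w) : Loc X (k + 1) false true w := by
  have hp : Block X (k + 1) false (w - len k true) :=
    ⟨h.prev, by rw [show w - len k true + q (k + 1) = w by simp only [len]; ring]; exact h.next⟩
  have h2 := hp.small_next h0 hX
  rw [show w - len k true + q (k + 1) = w by simp only [len]; ring] at h2
  exact ⟨hp, h2, h.pos, h.le⟩

/-- The long block before `w` absorbs the short one after it, which moves the boundary to the end of
the short block. -/
theorem Loc.succ_ii (h0 : NoDoubleZero X) (hX : NoTriple X) {k : ℕ} {w : ℤ}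
    (h : Loc X k true false w) : ∃ c', Loc X (k + 1) true c' (w + q k) := by
  have hp : Block X (k + 1) true (w - len k true) :=
    ⟨h.prev, by rw [show w - len k true + q (k + 1) = w by simp only [len]; ring]; exact h.next⟩
  have e : len (k + 1) true = len k true + q k := q_add_two k
  have e2 : w + q k - len (k + 1) true = w - len k true := by rw [e]; ring
  obtain ⟨c', hc'⟩ := hp.next h0 hX
  rw [show w - len k true + len (k + 1) true = w + q k by rw [e]; ring] at hc'
  have := h.pos
  have := h.le
  have := q_pos k
  exact ⟨c', by rw [e2]; exact hp, hc', by omega, by omega⟩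

/-- The short block ending at `w` is absorbed by the long block before it, so `w` stays a boundary.
-/
theorem Loc.succ_iii (h0 : NoDoubleZero X) (hX : NoTriple X) {k : ℕ} {w : ℤ}
    (h : Loc X k false true w) : ∃ c', Loc X (k + 1) true c' w := by
  have h1 := h.prev.prev_of_small h0 hX
  have e : len (k + 1) true = len k false + q (k + 1) := by
    simp only [len]; rw [q_add_two]; ring
  have hp : Block X (k + 1) true (w - len (k + 1) true) := by
    rw [show w - len (k + 1) true = w - len k false - q (k + 1) by rw [e]; ring]
    exact ⟨h1, by rw [sub_add_cancel]; exact h.prev⟩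
  obtain ⟨c', hc'⟩ := hp.next h0 hX
  rw [sub_add_cancel] at hc'
  have := h.le
  have := q_pos (k + 1)
  exact ⟨c', hp, hc', h.pos, by omega⟩

theorem Loc.exists (h0 : NoDoubleZero X) (hX : NoTriple X) (k : ℕ) : ∃ c c' w, Loc X k c c' w := by
  induction k with
  | zero =>
    obtain ⟨c, hc⟩ := bdry_zero (X := X) 0
    obtain ⟨c', hc'⟩ := bdry_zero (X := X) 1
    have e : len 0 c = 1 := by cases c <;> rfl
    exact ⟨c, c', 1, by rw [e]; exact hc, hc', le_rfl, e.ge⟩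
  | succ k ih =>
    obtain ⟨c, c', w, h⟩ := ih
    cases c <;> cases c'
    · exact absurd h (Loc.not_small h0 hX)
    · obtain ⟨d, hd⟩ := h.succ_iii h0 hX
      exact ⟨_, _, _, hd⟩
    · obtain ⟨d, hd⟩ := h.succ_ii h0 hX
      exact ⟨_, _, _, hd⟩
    · exact ⟨_, _, _, h.succ_i h0 hX⟩

theorem Loc.le_of_bdry {k : ℕ} {c c' : Bool} {w s : ℤ} (h : Loc X k c c' w)
    (hs : Bdry X k s) (h1 : 1 ≤ s) : w ≤ s := by
  have := h.prev.le_of_lt (s := s) (by linarith [h.le]) hs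
  linarith

theorem Loc.unique {k : ℕ} {c c' d d' : Bool} {w v : ℤ}
    (h : Loc X k c c' w) (h' : Loc X k d d' v) : c = d ∧ c' = d' ∧ w = v := by
  have e : w = v := le_antisymm (h.le_of_bdry h'.next.bdry h'.pos) (h'.le_of_bdry h.next.bdry h.pos)
  subst e
  refine ⟨?_, h.next.unique h'.next, rfl⟩
  have h1 := h.prev.last
  have h2 := h'.prev.last
  rw [sub_add_cancel] at h1 h2
  exact lastLetter_inj (h1.symm.trans h2)

/-! ### Repeated words and their possible positions -/

/-- The words of length `n` at the positions `j < j'` agree. -/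
structure Repeat (X : ℤ → Fin 2) (n j j' : ℤ) : Prop where
  nonneg : 0 ≤ j
  lt : j < j'
  agree : ∀ i : ℤ, 0 ≤ i → i < n → X (j + i) = X (j' + i)

theorem Repeat.shift_left {n j j' : ℤ} (h : Repeat X n j j') :
    ∃ d, 0 ≤ d ∧ Repeat X n (j - d) (j' - d) ∧
      (j - d = 0 ∨ X (j - d - 1) ≠ X (j' - d - 1)) := by
  obtain ⟨m, rfl⟩ := Int.eq_ofNat_of_zero_le h.nonneg
  induction m generalizing j' with
  | zero => exact ⟨0, le_rfl, by simpa using h, by simp⟩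
  | succ m ih =>
    by_cases hX : X (m : ℤ) = X (j' - 1)
    · have h2 : Repeat X n m (j' - 1) := by
        refine ⟨by omega, by have := h.lt; push_cast at this; omega, fun i hi hi' => ?_⟩
        rcases hi.eq_or_lt with rfl | hpos
        · simpa using hX
        · have := h.agree (i - 1) (by omega) (by omega)
          push_cast at this
          rw [show (m : ℤ) + 1 + (i - 1) = m + i by ring,
            show j' + (i - 1) = j' - 1 + i by ring] at this
          exact this
      obtain ⟨d, hd, h3, h4⟩ := ih h2
      refine ⟨d + 1, by omega, ?_, ?_⟩
      · push_cast
        rw [show (m : ℤ) + 1 - (d + 1) = m - d by ring, show j' - (d + 1) = j' - 1 - d by ring]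
        exact h3
      · push_cast
        rw [show (m : ℤ) + 1 - (d + 1) = m - d by ring, show j' - (d + 1) = j' - 1 - d by ring]
        exact h4
    · exact ⟨0, le_rfl, by simpa using h, Or.inr (by push_cast; simpa using hX)⟩

/-- A period `d` would, by recognizability, carry the boundary `w` of a level with blocks longer
than `d` to a boundary inside the block starting at `w`. -/
theorem not_periodic (h0 : NoDoubleZero X) (hX : NoTriple X) {d : ℤ} (hd : 0 < d) :
    ∃ i : ℤ, 0 ≤ i ∧ X i ≠ X (i + d) := by
  by_contra! hp
  obtain ⟨K, hK⟩ := Int.eq_ofNat_of_zero_le hd.le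
  obtain ⟨c, c', w, h⟩ := Loc.exists h0 hX (K + 1)
  have hw := h.pos
  have h2 : Bdry X (K + 1) (w + d) := by
    refine Bdry.of_agree h0 hX h.next.bdry fun i hi _ => ?_
    rw [hp (w + i) (by omega)]; congr 1; ring
  have h3 := natCast_le_q (K + 1)
  have h4 := le_len (K + 1) c'
  push_cast at h3
  exact h.next.gap (by omega) (by omega) h2

theorem Repeat.exists_maximal (h0 : NoDoubleZero X) (hX : NoTriple X) {n d : ℤ}
    (h : Repeat X n 0 d) : ∃ n', n ≤ n' ∧ Repeat X n' 0 d ∧ X n' ≠ X (n' + d) := by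
  classical
  obtain ⟨i, hi, hne⟩ := not_periodic h0 hX h.lt
  obtain ⟨i, rfl⟩ := Int.eq_ofNat_of_zero_le hi
  have hex : ∃ i : ℕ, X (i : ℤ) ≠ X (i + d) := ⟨i, hne⟩
  have key := Nat.find_spec hex
  refine ⟨(Nat.find hex : ℕ), ?_, ⟨le_rfl, h.lt, ?_⟩, key⟩
  · by_contra! hlt
    have := h.agree (Nat.find hex : ℕ) (by omega) hlt
    rw [zero_add, add_comm] at this
    exact key this
  · intro i hi hi'
    obtain ⟨i, rfl⟩ := Int.eq_ofNat_of_zero_le hi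
    have := Nat.find_min hex (m := i) (by exact_mod_cast hi')
    rw [zero_add, add_comm d]
    exact not_not.1 this

/-- If the prefix up to a boundary `s` recurs after `d` letters and `s + d` is a boundary,
then so is `w + d`, and it ends a block of the same type as `w`. -/
theorem Loc.walk_back (h0 : NoDoubleZero X) (hX : NoTriple X) {k : ℕ} {c c' : Bool} {w d : ℤ}
    (h : Loc X k c c' w) (m : ℕ) : ∀ {s : ℤ}, s ≤ m → w ≤ s → Bdry X k s → Bdry X k (s + d) →
    (∀ i : ℤ, 0 ≤ i → i < s → X i = X (i + d)) →
    Bdry X k (w + d) ∧ Block X k c (w + d - len k c) := by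
  induction m with
  | zero =>
    intro s hs hws
    have := h.pos
    push_cast at hs
    omega
  | succ m ih =>
    intro s hs hws hb hbd hag
    have hpos := h.pos
    have hl : X (s - 1) = X (s + d - 1) := by
      rw [hag (s - 1) (by omega) (by omega)]; congr 1; ring
    rcases hws.eq_or_lt with rfl | hlt
    · exact ⟨hbd, h.prev.prev_eq h0 hX hbd hl⟩
    · obtain ⟨e, he⟩ := hb.prev h0 hX
      have he2 := he.prev_eq h0 hX hbd hl
      have hlen := len_pos k e
      have hle : w ≤ s - len k e := by
        by_contra! hlt2
        have := he.le_of_lt hlt2 h.next.bdry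
        omega
      refine ih (s := s - len k e) (by push_cast at hs; omega) hle he.bdry ?_ ?_
      · rw [show s - len k e + d = s + d - len k e by ring]; exact he2.bdry
      · intro i hi hi'
        exact hag i hi (by omega)

/-- Possible positions of a repeat of length at least `q (k + 1) - 1`. -/
theorem Loc.repeat_cases (h0 : NoDoubleZero X) (hX : NoTriple X) {k : ℕ} {c c' : Bool}
    {w n j j' : ℤ} (h : Loc X k c c' w) (hn : q (k + 1) - 1 ≤ n) (hr : Repeat X n j j') :
    ∃ e, 0 < e ∧ e ≤ j' ∧ (w + len k c' ≤ e ∨ (len k c ≤ e ∧ n ≤ w - len k c + q (k + 2) - 2) ∨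
      Block X k c (w + e - len k c)) := by
  obtain ⟨d, hd, hr2, hj⟩ := hr.shift_left
  have hq := q_pos k
  have hq1 := q_pos (k + 1)
  have e2 := q_add_two k
  have hlt := hr2.lt
  have hnn := hr2.nonneg
  refine ⟨j' - d, by omega, by omega, ?_⟩
  generalize j - d = j at *
  generalize j' - d = j' at *
  -- At the origin, the repeat is extended to a mismatch and a boundary `s` is read off near its
  -- right end. Away from it, the word is left special and both positions are boundaries, the first
  -- at or after `w`.
  by_cases hj0 : j = 0
  · subst hj0
    obtain ⟨n', hn', hr3, hne⟩ := hr2.exists_maximal h0 hX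
    have hag : ∀ i : ℤ, 0 ≤ i → i < n' → X i = X (i + j') := fun i hi hi' => by
      have := hr3.agree i hi hi'
      rwa [zero_add, add_comm] at this
    obtain ⟨a, ha, ha'⟩ := block_of_right_special (k := k) h0 hX hne fun i hi hi' => by
      rw [hag (n' - i) (by omega) (by omega)]; congr 1; ring
    rw [show n' + j' - (q (k + 2) - 2) = n' - (q (k + 2) - 2) + j' by ring] at ha'
    obtain ⟨s, hs⟩ : ∃ s, s = n' - (q (k + 2) - 2) := ⟨_, rfl⟩
    rw [← hs] at ha ha'
    by_cases hws : w ≤ s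
    · have h1 := h.pos
      exact Or.inr (Or.inr (h.walk_back h0 hX s.toNat (by omega) hws ha.bdry ha'.bdry
        fun i hi hi' => hag i hi (by omega)).2)
    · right; left
      have h1 : s + len k a ≤ w := ha.le_of_lt (by omega) h.next.bdry
      have h2 := le_len k a
      have h3 : s = w - len k c := by
        refine le_antisymm ?_ ?_
        · by_contra! h4
          have h5 := h.prev.le_of_lt h4 ha.bdry
          have h6 := len_pos k a
          omega
        -- The bound `q (k+1) - 1 ≤ n` gives `s ≥ 1 - q k`, so the block at `s` ends after the
        -- origin and cannot lie before the one ending at `w`.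
        · by_contra! h4
          have h5 := ha.le_of_lt h4 h.prev.bdry
          have h6 := h.le
          omega
      have h7 : Block X k c s := by rw [h3]; exact h.prev
      have h8 := h7.le_of_lt (s := s + j') (by omega) ha'.bdry
      exact ⟨by omega, by omega⟩
  · obtain ⟨hb, hb'⟩ := bdry_of_left_special (k := k) h0 hX (hj.resolve_left hj0) fun i hi hi' =>
      hr2.agree i hi (by omega)
    left
    have := h.le_of_bdry hb (by omega)
    exact h.next.le_of_lt (by omega) hb'

theorem Loc.lower_i (h0 : NoDoubleZero X) (hX : NoTriple X) {k : ℕ} {w n j j' : ℤ}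
    (h : Loc X k true true w) (hn : q (k + 1) - 1 ≤ n) (hr : Repeat X n j j') :
    q (k + 1) ≤ j' := by
  have hw := h.pos
  obtain ⟨e, he, hej, h1 | ⟨h1, -⟩ | h1⟩ := h.repeat_cases h0 hX hn hr
  · simp only [len] at h1; omega
  · simp only [len] at h1; omega
  · obtain ⟨a, ha⟩ := h1.next h0 hX
    rw [sub_add_cancel] at ha
    have := h.next.le_of_lt (by omega) ha.bdry
    simp only [len] at this; omega

theorem Loc.lower_ii (h0 : NoDoubleZero X) (hX : NoTriple X) {k : ℕ} {w n j j' : ℤ}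
    (h : Loc X k true false w) (hn : q (k + 1) - 1 ≤ n) (hr : Repeat X n j j') :
    w + q k ≤ j' ∨ (q (k + 1) ≤ j' ∧ n ≤ w + q k - 2) := by
  have e2 := q_add_two k
  obtain ⟨e, he, hej, h1 | ⟨h1, h2⟩ | h1⟩ := h.repeat_cases h0 hX hn hr
  · simp only [len] at h1; omega
  · simp only [len] at h1 h2; omega
  · have hle := h.le
    simp only [len] at h1 hle
    have hn := h.next.small_next h0 hX
    have hn2 := h.next
    have hq := q_pos k
    -- A long block ending at `w + e` can neither overlap the short block at `w` nor end by `w`, so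
    -- it starts after that short block.
    have h3 : w + q k ≤ w + e - q (k + 1) := by
      by_contra! h4
      by_cases h5 : w < w + e - q (k + 1)
      · exact absurd (h.next.le_of_lt h5 h1.bdry) (by simp only [len]; omega)
      · rcases (not_lt.1 h5).eq_or_lt with h6 | h6
        · rw [h6] at h1
          exact absurd (h1.unique h.next) (by simp)
        · have := h1.le_of_lt h6 h.next.bdry
          simp only [len] at this
          omega
    left
    omega

theorem Loc.lower_iii (h0 : NoDoubleZero X) (hX : NoTriple X) {k : ℕ} {w n j j' : ℤ}
    (h : Loc X k false true w) (hn : q (k + 1) - 1 ≤ n) (hr : Repeat X n j j') :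
    w + q (k + 1) ≤ j' ∨ (q k ≤ j' ∧ n ≤ w + q (k + 1) - 2) := by
  have e2 := q_add_two k
  obtain ⟨e, he, hej, h1 | ⟨h1, h2⟩ | h1⟩ := h.repeat_cases h0 hX hn hr
  · simp only [len] at h1; omega
  · simp only [len] at h1 h2; omega
  · have hle := h.le
    simp only [len] at h1 hle
    have hq := q_pos k
    have h3 : w + q (k + 1) ≤ w + e - q k := by
      by_contra! h4
      by_cases h5 : w < w + e - q k
      · exact absurd (h.next.le_of_lt h5 h1.bdry) (by simp only [len]; omega)
      · rcases (not_lt.1 h5).eq_or_lt with h6 | h6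
        · rw [h6] at h1
          exact absurd (h1.unique h.next) (by simp)
        · have := h1.le_of_lt h6 h.next.bdry
          simp only [len] at this
          omega
    left
    omega

theorem Loc.repeat_prev (h0 : NoDoubleZero X) (hX : NoTriple X) {k : ℕ} {c c' : Bool} {w : ℤ}
    (h : Loc X k c c' w) : Repeat X (w - len k c + q (k + 2) - 2) 0 (len k c) := by
  refine ⟨le_rfl, len_pos k c, fun i hi hi' => ?_⟩
  have hle := h.le
  have := h.prev.bdry.agree h0 hX h.next.bdry (i - (w - len k c)) (by omega) (by omega)
  rw [show w - len k c + (i - (w - len k c)) = 0 + i by ring,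
    show w + (i - (w - len k c)) = len k c + i by ring] at this
  exact this

theorem Loc.repeat_next (h0 : NoDoubleZero X) (hX : NoTriple X) {k : ℕ} {c c' : Bool} {w : ℤ}
    (h : Loc X k c c' w) : Repeat X (q (k + 2) - 2) w (w + len k c') := by
  have := h.pos
  have := len_pos k c'
  exact ⟨by omega, by omega, fun i hi hi' => h.next.bdry.agree h0 hX (h.next.next h0 hX) i hi hi'⟩

/-- The two blocks at `w` are equal in full, so the prefix repeat goes on through the common word
read at both ends of the second block, longer than what `Loc.repeat_prev` gives. -/
theorem Loc.repeat_i (h0 : NoDoubleZero X) (hX : NoTriple X) {k : ℕ} {w : ℤ}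
    (h : Loc X k true true w) : Repeat X (w + q (k + 2) - 2) 0 (q (k + 1)) := by
  refine ⟨le_rfl, q_pos _, fun i hi hi' => ?_⟩
  have hle := h.le
  simp only [len] at hle
  by_cases hiw : i < w
  · have := h.prev.agree h.next (i - (w - len k true)) (by simp only [len]; omega)
      (by simp only [len]; omega)
    simp only [len] at this
    rw [show w - q (k + 1) + (i - (w - q (k + 1))) = 0 + i by ring,
      show w + (i - (w - q (k + 1))) = q (k + 1) + i by ring] at this
    exact this
  · have := h.next.bdry.agree h0 hX (h.next.next h0 hX) (i - w) (by omega) (by omega)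
    simp only [len] at this
    rw [show w + (i - w) = 0 + i by ring,
      show w + q (k + 1) + (i - w) = q (k + 1) + i by ring] at this
    exact this

/-! ### Blocks as finite words; the three cases in terms of blocks -/

variable {x : ℕ → Fin 2}

/-- The word read in a block of type `c` of level `k + 1`. -/
def word (k : ℕ) : Bool → List (Fin 2)
  | true => M (k + 1)
  | false => M k

theorem length_M : ∀ k, ((M k).length : ℤ) = q k := by
  intro k
  induction k using Nat.twoStepInduction with
  | zero => rfl
  | one => rfl
  | more k h1 h2 => simp only [M, List.length_append]; push_cast; rw [h1, h2, q_add_two]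

theorem length_word (k : ℕ) (c : Bool) : ((word k c).length : ℤ) = len k c := by
  cases c <;> exact length_M _

theorem lastLetter_suffix : ∀ k c, [lastLetter k c] <:+ word k c := by
  intro k
  induction k with
  | zero => intro c; cases c <;> exact List.suffix_rfl
  | succ k ih =>
    intro c
    cases c
    · exact ih true
    · exact (ih false).trans (List.suffix_append _ _)

/-- The finite word `u` occurs in `X` at position `p`. -/
def OccZ (X : ℤ → Fin 2) (u : List (Fin 2)) (p : ℤ) : Prop :=
  ∀ (i : ℕ) (h : i < u.length), X (p + i) = u[i]

theorem occZ_append {u v : List (Fin 2)} {p : ℤ} :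
    OccZ X (u ++ v) p ↔ OccZ X u p ∧ OccZ X v (p + u.length) := by
  constructor
  · intro h
    refine ⟨fun i hi => ?_, fun i hi => ?_⟩
    · rw [h i (by simp; omega), List.getElem_append_left hi]
    · have := h (u.length + i) (by simp; omega)
      rw [List.getElem_append_right (by omega)] at this
      push_cast at this
      simpa [add_assoc] using this
  · rintro ⟨h1, h2⟩ i hi
    by_cases hlt : i < u.length
    · rw [h1 i hlt, List.getElem_append_left hlt]
    · rw [List.getElem_append_right (by omega), ← h2 (i - u.length) (by simp at hi; omega)]
      congr 1; omega

theorem Block.occZ : ∀ {k : ℕ} {c : Bool} {p : ℤ}, Block X k c p → OccZ X (word k c) p := by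
  intro k
  induction k with
  | zero =>
    intro c p h i hi
    cases c <;> simp only [word, M, List.length_singleton] at hi <;>
      obtain rfl : i = 0 := by omega
    all_goals simpa [word, M, Block] using h
  | succ k ih =>
    intro c p h
    cases c with
    | false => exact ih h.1
    | true =>
      refine occZ_append.2 ⟨ih h.1, ?_⟩
      rw [length_M]
      exact ih h.2

/-- Near-commutation: the two products of consecutive words differ only by exchanging their last two
letters. This is why those letters are removed in `Mtilde`. -/
theorem exists_M_append_M (k : ℕ) : ∃ T a b, M (k + 1) ++ M k = T ++ [a, b] ∧
    M k ++ M (k + 1) = T ++ [b, a] := by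
  induction k with
  | zero => exact ⟨[], 1, 0, rfl, rfl⟩
  | succ k ih =>
    obtain ⟨T, a, b, h1, h2⟩ := ih
    refine ⟨M (k + 1) ++ T, b, a, ?_, ?_⟩
    · rw [show M (k + 1 + 1) = M (k + 1) ++ M k from rfl, List.append_assoc, h2, List.append_assoc]
    · rw [show M (k + 1 + 1) = M (k + 1) ++ M k from rfl, h1, List.append_assoc]

theorem dropLast_dropLast_append_pair {α : Type} (T : List α) (a b : α) :
    (T ++ [a, b]).dropLast.dropLast = T := by
  rw [show T ++ [a, b] = (T ++ [a]) ++ [b] by simp, List.dropLast_concat, List.dropLast_concat]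

theorem Mtilde_succ (k : ℕ) : Mtilde (k + 2) = M (k + 1) ++ Mtilde (k + 1) := by
  obtain ⟨T, a, b, h1, h2⟩ := exists_M_append_M k
  have e1 : Mtilde (k + 1) = T := by
    simp only [Mtilde, Nat.add_sub_cancel]
    rw [h1, dropLast_dropLast_append_pair]
  rw [e1]
  simp only [Mtilde, show k + 2 - 1 = k + 1 from rfl, M]
  rw [List.append_assoc, h2, ← List.append_assoc, dropLast_dropLast_append_pair]

theorem length_Mtilde : ∀ k, ((Mtilde (k + 1)).length : ℤ) = q (k + 2) - 2 := by
  intro k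
  induction k with
  | zero => rfl
  | succ k ih =>
    rw [Mtilde_succ, List.length_append]
    push_cast
    rw [ih, length_M, q_add_two (k + 1)]; ring

theorem Bdry.occZ (h0 : NoDoubleZero X) (hX : NoTriple X) : ∀ {k : ℕ} {p : ℤ}, Bdry X k p →
    OccZ X (Mtilde (k + 1)) p := by
  intro k
  induction k with
  | zero =>
    intro p _ i hi
    have : (Mtilde (0 + 1)).length = 0 := rfl
    omega
  | succ k ih =>
    intro p h
    rw [Mtilde_succ, occZ_append]
    refine ⟨h.large.occZ, ?_⟩
    rw [length_M]
    exact ih (h.large.next h0 hX)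

theorem Bdry.of_occZ (h0 : NoDoubleZero X) (hX : NoTriple X) {k : ℕ} {p : ℤ}
    (h : OccZ X (Mtilde (k + 1)) p) : Bdry X k p := by
  obtain ⟨c, c', w, hl⟩ := Loc.exists h0 hX k
  have h2 := hl.next.bdry.occZ h0 hX
  refine Bdry.of_agree h0 hX hl.next.bdry fun i hi hi' => ?_
  obtain ⟨i, rfl⟩ := Int.eq_ofNat_of_zero_le hi
  rw [← length_Mtilde] at hi'
  rw [h i (by omega), h2 i (by omega)]

/-- The word is `Mtilde (k+2)`, which marks the boundaries one level up, and these are the starts of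
long blocks. -/
theorem Block.of_occZ (h0 : NoDoubleZero X) (hX : NoTriple X) {k : ℕ} {p : ℤ}
    (h : OccZ X (M (k + 1) ++ Mtilde (k + 1)) p) : Block X k true p := by
  rw [← Mtilde_succ] at h
  exact (Bdry.of_occZ (k := k + 1) h0 hX h).large

/-- The last letter of a nonempty suffix of a block. -/
theorem OccZ.last {k : ℕ} {c : Bool} {W : List (Fin 2)} {p : ℤ} (hW : W ≠ [])
    (hs : W <:+ word k c) (h : OccZ X W p) : X (p + W.length - 1) = lastLetter k c := by
  have hlen := List.length_pos_iff.2 hW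
  obtain ⟨u, rfl⟩ := List.suffix_of_suffix_length_le (lastLetter_suffix k c) hs
    (by simpa using Nat.succ_le_of_lt hlen)
  rw [occZ_append] at h
  have := h.2 0 (by simp)
  simp only [Nat.cast_zero, add_zero, List.getElem_cons_zero] at this
  rw [← this]; congr 1; simp; ring

/-- The case of the locating chain given by the types of the blocks before and after `w`. -/
def caseOf : Bool → Bool → LocCase
  | true, true => .i
  | true, false => .ii
  | false, _ => .iii

theorem occursAt_iff_occZ (hx : ∀ n : ℕ, X n = x n) (u : List (Fin 2)) :
    OccursAt x u 0 ↔ OccZ X u 0 := by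
  unfold OccursAt OccZ
  refine forall₂_congr fun i hi => ?_
  rw [zero_add, zero_add, hx]

theorem Loc.inCaseWith (h0 : NoDoubleZero X) (hX : NoTriple X) (hx : ∀ n : ℕ, X n = x n)
    {k : ℕ} {c c' : Bool} {w : ℤ} (h : Loc X k c c' w) :
    ∃ W, InCaseWith x (k + 1) (caseOf c c') W := by
  obtain ⟨V, W, hVW, hW⟩ : ∃ V W, V ++ W = word k c ∧ (W.length : ℤ) = w := by
    refine ⟨(word k c).take ((word k c).length - w.toNat),
      (word k c).drop ((word k c).length - w.toNat), List.take_append_drop _ _, ?_⟩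
    have := length_word k c
    have := h.le
    have := h.pos
    rw [List.length_drop]
    omega
  have hocc : OccZ X W 0 := by
    have := h.prev.occZ
    rw [← hVW, occZ_append] at this
    have h2 := this.2
    have h3 := length_word k c
    rw [← hVW, List.length_append] at h3
    push_cast at h3
    rwa [show w - len k c + (V.length : ℤ) = 0 by omega] at h2
  have hne : W ≠ [] := by
    rintro rfl
    have := h.pos
    simp at hW
    omega
  have hsuf : W <:+ word k c := ⟨V, hVW⟩
  refine ⟨W, ?_⟩
  have long : ∀ p, Block X k true p → OccZ X (M (k + 1) ++ Mtilde (k + 1)) p := fun p hp =>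
    occZ_append.2 ⟨hp.occZ, by rw [length_M]; exact (hp.next h0 hX).occZ h0 hX⟩
  cases c <;> cases c'
  · exact absurd h (Loc.not_small h0 hX)
  · refine ⟨hne, hsuf, ?_⟩
    rw [occursAt_iff_occZ hx, List.append_assoc, occZ_append]
    exact ⟨hocc, long _ (by rw [hW, zero_add]; exact h.next)⟩
  · refine ⟨hne, hsuf, ?_⟩
    rw [occursAt_iff_occZ hx, List.append_assoc, List.append_assoc, occZ_append, occZ_append]
    rw [hW, zero_add, Nat.add_sub_cancel, length_M]
    exact ⟨hocc, h.next.occZ, long _ (h.next.small_next h0 hX)⟩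
  · refine ⟨hne, hsuf, ?_⟩
    rw [occursAt_iff_occZ hx, List.append_assoc, occZ_append]
    exact ⟨hocc, long _ (by rw [hW, zero_add]; exact h.next)⟩

theorem loc_of_occZ (h0 : NoDoubleZero X) (hX : NoTriple X) {k : ℕ} {c c' : Bool}
    {W : List (Fin 2)} (hW : W ≠ []) (hs : W <:+ word k c) (h : OccZ X W 0)
    (hb : Block X k c' W.length) : Loc X k c c' W.length := by
  have h1 := h.last hW hs
  rw [zero_add] at h1
  have h2 := hs.length_le
  have h3 := length_word k c
  have h4 := List.length_pos_iff.2 hW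
  exact ⟨hb.bdry.prev_of_last h0 hX h1, hb, by omega, by omega⟩

theorem InCaseWith.loc (h0 : NoDoubleZero X) (hX : NoTriple X) (hx : ∀ n : ℕ, X n = x n)
    {k : ℕ} {a : LocCase} {W : List (Fin 2)} (h : InCaseWith x (k + 1) a W) :
    ∃ c c', a = caseOf c c' ∧ W <:+ word k c ∧ Loc X k c c' W.length := by
  cases a with
  | i =>
    obtain ⟨hW, hs, ho⟩ := h
    rw [occursAt_iff_occZ hx, List.append_assoc, occZ_append, zero_add] at ho
    exact ⟨true, true, rfl, hs, loc_of_occZ h0 hX hW hs ho.1 (Block.of_occZ h0 hX ho.2)⟩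
  | ii =>
    obtain ⟨hW, hs, ho⟩ := h
    rw [occursAt_iff_occZ hx, List.append_assoc, List.append_assoc, occZ_append, occZ_append,
      zero_add, Nat.add_sub_cancel] at ho
    obtain ⟨h1, h2, h3⟩ := ho
    have h4 := Block.of_occZ h0 hX h3
    have h5 : M k ≠ [] := by
      have := length_M k
      have := q_pos k
      intro h
      simp [h] at *
      omega
    -- An occurrence of `M k` alone need not be a block; the long block after it supplies a
    -- boundary, and the last letter of `M k` identifies the short block ending there.
    have h6 := h4.bdry.prev_of_last h0 hX (h2.last (c := false) h5 List.suffix_rfl)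
    rw [length_M, show (W.length : ℤ) + q k - len k false = W.length by simp only [len]; ring] at h6
    exact ⟨true, false, rfl, hs, loc_of_occZ h0 hX hW hs h1 h6⟩
  | iii =>
    obtain ⟨hW, hs, ho⟩ := h
    rw [occursAt_iff_occZ hx, List.append_assoc, occZ_append, zero_add] at ho
    exact ⟨false, true, rfl, hs, loc_of_occZ (c := false) h0 hX hW hs ho.1
      (Block.of_occZ h0 hX ho.2)⟩

theorem existsUnique_inCaseWith (h0 : NoDoubleZero X) (hX : NoTriple X) (hx : ∀ n : ℕ, X n = x n)
    {k : ℕ} (hk : 1 ≤ k) : ∃! p : LocCase × List (Fin 2), InCaseWith x k p.1 p.2 := by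
  obtain ⟨k, rfl⟩ := Nat.exists_eq_add_of_le' hk
  obtain ⟨c, c', w, h⟩ := Loc.exists h0 hX k
  obtain ⟨W, hW⟩ := h.inCaseWith h0 hX hx
  refine ⟨(caseOf c c', W), hW, ?_⟩
  rintro ⟨a, V⟩ hV
  obtain ⟨d, d', -, hs, hl⟩ := InCaseWith.loc h0 hX hx hW
  obtain ⟨e, e', he, hs', hl'⟩ := InCaseWith.loc h0 hX hx hV
  obtain ⟨rfl, rfl, rfl⟩ := h.unique hl
  obtain ⟨rfl, rfl, hlen⟩ := hl.unique hl'
  dsimp only at hs' hlen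
  have hVW : V = W := by
    rw [List.suffix_iff_eq_drop.1 hs, List.suffix_iff_eq_drop.1 hs']
    congr 2
    exact_mod_cast hlen.symm
  rw [hVW, show a = caseOf c c' from he]

theorem Loc.locatingChain_eq (h0 : NoDoubleZero X) (hX : NoTriple X) (hx : ∀ n : ℕ, X n = x n)
    {k : ℕ} {c c' : Bool} {w : ℤ} (h : Loc X k c c' w) : locatingChain x k = caseOf c c' := by
  have h1 : ∃ a, InCase x (k + 1) a := ⟨_, h.inCaseWith h0 hX hx⟩
  obtain ⟨W, hW⟩ : InCase x (k + 1) (locatingChain x k) := Classical.epsilon_spec h1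
  obtain ⟨d, d', e, -, hl⟩ := InCaseWith.loc h0 hX hx hW
  obtain ⟨rfl, rfl, -⟩ := h.unique hl
  exact e

/-! ### From repeats to the function `r` -/

theorem r_le_of_repeat (hx : ∀ n : ℕ, X n = x n) {n m : ℕ} {j j' : ℤ} (hm : (n : ℤ) ≤ m)
    (h : Repeat X m j j') : (r n x : ℤ) - n ≤ j' := by
  obtain ⟨j, rfl⟩ := Int.eq_ofNat_of_zero_le h.nonneg
  obtain ⟨j', rfl⟩ := Int.eq_ofNat_of_zero_le (h.nonneg.trans h.lt.le)
  have : r n x ≤ j' + n := by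
    refine Nat.sInf_le ⟨j, j', by exact_mod_cast h.lt, rfl, fun i hi => ?_⟩
    have := h.agree i (by omega) (by omega)
    rw [← Nat.cast_add, ← Nat.cast_add, hx, hx] at this
    exact this
  omega

theorem exists_repeat (h0 : NoDoubleZero X) (hX : NoTriple X) (hx : ∀ n : ℕ, X n = x n) (n : ℕ) :
    ∃ j j', Repeat X n j j' ∧ (r n x : ℤ) - n = j' := by
  -- Without nonemptiness `sInf` would be the default value 0. Level n + 1 supplies a repeat of
  -- length `q (n+2) - 2 ≥ n`.
  have hne : {m : ℕ | ∃ j k : ℕ, j < k ∧ m = k + n ∧ ∀ i < n, x (j + i) = x (k + i)}.Nonempty := by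
    obtain ⟨c, c', w, h⟩ := Loc.exists h0 hX n
    have hr := h.repeat_next h0 hX
    have h1 := natCast_le_q (n + 2)
    push_cast at h1
    obtain ⟨j, hj⟩ := Int.eq_ofNat_of_zero_le hr.nonneg
    obtain ⟨j', hj'⟩ := Int.eq_ofNat_of_zero_le (hr.nonneg.trans hr.lt.le)
    rw [hj] at hr
    rw [hj] at hj'
    rw [hj'] at hr
    refine ⟨j' + n, j, j', by exact_mod_cast hr.lt, rfl, fun i hi => ?_⟩
    have := hr.agree i (by omega) (by omega)
    rw [← Nat.cast_add, ← Nat.cast_add, hx, hx] at this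
    exact this
  obtain ⟨j, k, hjk, hk, hag⟩ := Nat.sInf_mem hne
  refine ⟨j, k, ⟨by omega, by omega, fun i hi hi' => ?_⟩, ?_⟩
  · obtain ⟨i, rfl⟩ := Int.eq_ofNat_of_zero_le hi
    have := hag i (by omega)
    rw [← Nat.cast_add, ← Nat.cast_add, hx, hx]
    exact this
  · have : r n x = k + n := hk
    omega

/-- The lengths `w k` of the words of the locating chain `s`, and the bounds on `r` that the
chain gives. -/
structure ChainData (x : ℕ → Fin 2) (s : ℕ → LocCase) (w : ℕ → ℤ) : Prop where
  pos : ∀ k, 1 ≤ w k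
  le : ∀ k, w k ≤ q (k + 1)
  le_iii : ∀ k, s k = .iii → w k ≤ q k
  next_i : ∀ k, s k = .i → s (k + 1) = .iii ∧ w (k + 1) = w k
  next_ii : ∀ k, s k = .ii → s (k + 1) ≠ .iii ∧ w (k + 1) = w k + q k
  next_iii : ∀ k, s k = .iii → s (k + 1) ≠ .iii ∧ w (k + 1) = w k
  lower_i : ∀ k (n : ℕ), s k = .i → q (k + 1) - 1 ≤ n → q (k + 1) ≤ (r n x : ℤ) - n
  lower_ii : ∀ k (n : ℕ), s k = .ii → q (k + 1) - 1 ≤ n →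
    w k + q k ≤ (r n x : ℤ) - n ∨ (q (k + 1) ≤ (r n x : ℤ) - n ∧ n ≤ w k + q k - 2)
  lower_iii : ∀ k (n : ℕ), s k = .iii → q (k + 1) - 1 ≤ n →
    w k + q (k + 1) ≤ (r n x : ℤ) - n ∨ (q k ≤ (r n x : ℤ) - n ∧ n ≤ w k + q (k + 1) - 2)
  upper_i : ∀ k (n : ℕ), s k = .i → (n : ℤ) = w k + q (k + 2) - 2 → (r n x : ℤ) - n ≤ q (k + 1)
  upper_ii : ∀ k (n : ℕ), s k = .ii → (n : ℤ) = q (k + 2) - 2 → (r n x : ℤ) - n ≤ w k + q k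
  upper_ii' : ∀ k (n : ℕ), s k = .ii → (n : ℤ) = w k + q k - 2 → (r n x : ℤ) - n ≤ q (k + 1)

theorem exists_chainData (h0 : NoDoubleZero X) (hX : NoTriple X) (hx : ∀ n : ℕ, X n = x n) :
    ∃ w, ChainData x (locatingChain x) w := by
  choose c c' w h using Loc.exists h0 hX
  have hs : ∀ k, locatingChain x k = caseOf (c k) (c' k) := fun k =>
    (h k).locatingChain_eq h0 hX hx
  have hi : ∀ k, locatingChain x k = .i → Loc X k true true (w k) := fun k hk => by
    have := h k
    rw [hs] at hk
    cases h1 : c k <;> cases h2 : c' k <;> simp [h1, h2, caseOf] at hk this ⊢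
    exact this
  have hii : ∀ k, locatingChain x k = .ii → Loc X k true false (w k) := fun k hk => by
    have := h k
    rw [hs] at hk
    cases h1 : c k <;> cases h2 : c' k <;> simp [h1, h2, caseOf] at hk this ⊢
    exact this
  have hiii : ∀ k, locatingChain x k = .iii → Loc X k false true (w k) := fun k hk => by
    have := h k
    rw [hs] at hk
    cases h1 : c k <;> cases h2 : c' k <;> simp [h1, h2, caseOf] at hk this ⊢
    · exact absurd this (Loc.not_small h0 hX)
    · exact this
  have hne : ∀ k c₂, c k = true → caseOf (c k) c₂ ≠ .iii := by
    intro k c₂ hk; rw [hk]; cases c₂ <;> simp [caseOf]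
  refine ⟨w, ?_, ?_, ?_, ?_, ?_, ?_, ?_, ?_, ?_, ?_, ?_, ?_⟩
  · exact fun k => (h k).pos
  · intro k
    refine (h k).le.trans ?_
    cases c k
    · exact q_le_succ k
    · exact le_rfl
  · exact fun k hk => (hiii k hk).le
  · intro k hk
    obtain ⟨e1, e2, e3⟩ := ((hi k hk).succ_i h0 hX).unique (h (k + 1))
    exact ⟨by rw [hs, ← e1]; rfl, e3.symm⟩
  · intro k hk
    obtain ⟨d, hd⟩ := (hii k hk).succ_ii h0 hX
    obtain ⟨e1, e2, e3⟩ := hd.unique (h (k + 1))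
    exact ⟨by rw [hs]; exact hne _ _ e1.symm, e3.symm⟩
  · intro k hk
    obtain ⟨d, hd⟩ := (hiii k hk).succ_iii h0 hX
    obtain ⟨e1, e2, e3⟩ := hd.unique (h (k + 1))
    exact ⟨by rw [hs]; exact hne _ _ e1.symm, e3.symm⟩
  · intro k n hk hn
    obtain ⟨j, j', hr, e⟩ := exists_repeat h0 hX hx n
    rw [e]; exact (hi k hk).lower_i h0 hX hn hr
  · intro k n hk hn
    obtain ⟨j, j', hr, e⟩ := exists_repeat h0 hX hx n
    rw [e]; exact (hii k hk).lower_ii h0 hX hn hr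
  · intro k n hk hn
    obtain ⟨j, j', hr, e⟩ := exists_repeat h0 hX hx n
    rw [e]; exact (hiii k hk).lower_iii h0 hX hn hr
  · intro k n hk hn
    have := (hi k hk).repeat_i h0 hX
    rw [← hn] at this
    exact r_le_of_repeat hx le_rfl this
  · intro k n hk hn
    have := (hii k hk).repeat_next h0 hX
    rw [← hn] at this
    exact r_le_of_repeat hx le_rfl this
  · intro k n hk hn
    have := (hii k hk).repeat_prev h0 hX
    rw [show w k - len k true + q (k + 2) - 2 = n by
      rw [hn, q_add_two]; simp only [len]; ring] at this
    exact r_le_of_repeat hx le_rfl this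

/-! ### Combinatorics of the locating chain -/

section Occurrences

variable {α : Type} {s : ℕ → α}

theorem occursAt_append {u v : List α} {p : ℕ} :
    OccursAt s (u ++ v) p ↔ OccursAt s u p ∧ OccursAt s v (p + u.length) := by
  constructor
  · intro h
    refine ⟨fun i hi => ?_, fun i hi => ?_⟩
    · rw [h i (by simp; omega), List.getElem_append_left hi]
    · have := h (u.length + i) (by simp; omega)
      rw [List.getElem_append_right (by omega)] at this
      simpa [add_assoc] using this
  · rintro ⟨h1, h2⟩ i hi
    by_cases hlt : i < u.length
    · rw [h1 i hlt, List.getElem_append_left hlt]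
    · rw [List.getElem_append_right (by omega), ← h2 (i - u.length) (by simp at hi; omega)]
      congr 1; omega

theorem occursAt_nil {p : ℕ} : OccursAt s [] p := fun i hi => absurd hi (by simp)

theorem occursAt_cons {a : α} {u : List α} {p : ℕ} :
    OccursAt s (a :: u) p ↔ s p = a ∧ OccursAt s u (p + 1) := by
  rw [show a :: u = [a] ++ u from rfl, occursAt_append]
  refine and_congr ⟨fun h => h 0 (by simp), fun h i hi => ?_⟩ Iff.rfl
  simp only [List.length_singleton, Nat.lt_one_iff] at hi
  subst hi
  exact h

end Occurrences

theorem occursAt_wpow {s : ℕ → LocCase} {u : List LocCase} {d : ℕ} : ∀ {p : ℕ},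
    OccursAt s (wpow u d) p ↔ ∀ j < d, OccursAt s u (p + j * u.length) := by
  induction d with
  | zero => intro p; exact ⟨fun _ j hj => absurd hj (by simp), fun _ => occursAt_nil⟩
  | succ d ih =>
    intro p
    rw [show wpow u (d + 1) = u ++ wpow u d by simp [wpow, List.replicate_succ],
      occursAt_append, ih]
    constructor
    · rintro ⟨h1, h2⟩ j hj
      cases j with
      | zero => simpa using h1
      | succ j =>
        have := h2 j (by omega)
        rwa [show p + (j + 1) * u.length = p + u.length + j * u.length by ring]
    · intro h
      refine ⟨by simpa using h 0 (by omega), fun j hj => ?_⟩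
      have := h (j + 1) (by omega)
      rwa [show p + (j + 1) * u.length = p + u.length + j * u.length by ring] at this

theorem length_wpow (u : List LocCase) (d : ℕ) : (wpow u d).length = d * u.length := by
  simp [wpow]

theorem isAChain_iff {s : ℕ → LocCase} {m p : ℕ} : IsAChain s m p ↔ 1 ≤ m ∧ s p = .ii ∧
    (∀ j < m, s (p + 1 + 2 * j) = .i ∧ s (p + 2 + 2 * j) = .iii) ∧ s (p + 1 + 2 * m) = .ii := by
  unfold IsAChain
  rw [occursAt_append, occursAt_append, occursAt_wpow]
  simp only [blockA, blockB, occursAt_cons, occursAt_nil, and_true, List.length_append,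
    length_wpow, List.length_cons, List.length_nil, zero_add, and_assoc, Nat.reduceAdd]
  refine and_congr Iff.rfl (and_congr Iff.rfl (and_congr (forall₂_congr fun j _ => ?_) ?_))
  · rw [show p + 1 + j * 2 = p + 1 + 2 * j by ring, show p + 1 + 2 * j + 1 = p + 2 + 2 * j by ring]
  · rw [show p + (1 + m * 2) = p + 1 + 2 * m by ring]

theorem isBChain_iff {s : ℕ → LocCase} {l p : ℕ} : IsBChain s l p ↔ 1 ≤ l ∧ s p = .i ∧
    s (p + 1) = .iii ∧ (∀ j < l, s (p + 2 + j) = .ii) ∧ s (p + 2 + l) = .i ∧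
    s (p + 3 + l) = .iii := by
  unfold IsBChain
  rw [occursAt_append, occursAt_append, occursAt_wpow]
  simp only [blockA, blockB, occursAt_cons, occursAt_nil, and_true, List.length_append,
    length_wpow, List.length_cons, List.length_nil, zero_add, and_assoc, Nat.reduceAdd, mul_one]
  rw [show p + (2 + l) = p + 2 + l by ring, show p + 2 + l + 1 = p + 3 + l by ring]

theorem cycle_blockB (n : ℕ) : Stream'.cycle blockB blockB_ne_nil n = .ii := by
  induction n with
  | zero => rw [Stream'.cycle_eq]; rfl
  | succ n ih => rw [Stream'.cycle_eq]; exact ih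

theorem cycle_blockA (n : ℕ) : Stream'.cycle blockA blockA_ne_nil (2 * n) = .i ∧
    Stream'.cycle blockA blockA_ne_nil (2 * n + 1) = .iii := by
  induction n with
  | zero => rw [Stream'.cycle_eq]; exact ⟨rfl, rfl⟩
  | succ n ih => rw [Stream'.cycle_eq]; exact ih

theorem append_stream_apply {α : Type} (u : List α) (t : Stream' α) (n : ℕ) :
    (u ++ₛ t) (u.length + n) = t n := by
  induction u with
  | nil => simp
  | cons a u ih =>
    rw [Stream'.cons_append_stream, List.length_cons, add_right_comm]
    exact ih

variable {s : Stream' LocCase} {w : ℕ → ℤ}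

/-- Eventually the chain consists of blocks `a`. -/
def EventuallyA (s : ℕ → LocCase) : Prop := ∃ K, ∀ k, K ≤ k → s k ≠ .ii

/-- Eventually the chain consists of blocks `b`. -/
def EventuallyB (s : ℕ → LocCase) : Prop := ∃ K, ∀ k, K ≤ k → s k = .ii

theorem ChainData.alternate (h : ChainData x s w) {k m : ℕ} (hk : s k = .i)
    (hm : ∀ j, k ≤ j → j < k + 2 * m → s j ≠ .ii) :
    ∀ j, j < m → s (k + 2 * j) = .i ∧ s (k + 2 * j + 1) = .iii := by
  intro j
  induction j with
  | zero => exact fun _ => ⟨hk, (h.next_i k hk).1⟩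
  | succ j ih =>
    intro hj
    have h1 := h.next_iii _ (ih (by omega)).2
    have h2 := hm (k + 2 * (j + 1)) (by omega) (by omega)
    have h3 : s (k + 2 * (j + 1)) ≠ .iii := h1.1
    have h4 : s (k + 2 * (j + 1)) = .i := by
      cases h5 : s (k + 2 * (j + 1)) <;> simp_all
    exact ⟨h4, (h.next_i _ h4).1⟩

/-- A tail without (ii) starts with (i) after at most one letter, and from there (i) and (iii) must
alternate. -/
theorem ChainData.eventuallyA_iff (h : ChainData x s w) : EventuallyA s ↔
    ∃ u : List LocCase, s = u ++ₛ Stream'.cycle blockA blockA_ne_nil := by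
  constructor
  · rintro ⟨K, hK⟩
    obtain ⟨k, hk, hki⟩ : ∃ k, K ≤ k ∧ s k = .i := by
      cases hs : s K with
      | i => exact ⟨K, le_rfl, hs⟩
      | ii => exact absurd hs (hK K le_rfl)
      | iii =>
        refine ⟨K + 1, by omega, ?_⟩
        have h1 := (h.next_iii K hs).1
        have h2 := hK (K + 1) (by omega)
        cases h5 : s (K + 1) <;> simp_all
    refine ⟨s.take k, ?_⟩
    have : s.drop k = Stream'.cycle blockA blockA_ne_nil := by
      funext n
      have hn := h.alternate (m := n + 1) hki (fun j hj _ => hK j (by omega)) (n / 2) (by omega)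
      have hc := cycle_blockA (n / 2)
      show s (n + k) = _
      rcases Nat.even_or_odd' n with ⟨m, rfl | rfl⟩
      · rw [show 2 * m / 2 = m by omega] at hn hc
        rw [hc.1, add_comm, hn.1]
      · rw [show (2 * m + 1) / 2 = m by omega] at hn hc
        rw [hc.2, add_comm, ← add_assoc, hn.2]
    rw [← this, Stream'.append_take_drop]
  · rintro ⟨u, hu⟩
    refine ⟨u.length, fun k hk => ?_⟩
    obtain ⟨n, rfl⟩ := Nat.exists_eq_add_of_le hk
    rw [hu, append_stream_apply]
    rcases Nat.even_or_odd' n with ⟨m, rfl | rfl⟩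
    · rw [(cycle_blockA m).1]; simp
    · rw [(cycle_blockA m).2]; simp

theorem eventuallyB_iff : EventuallyB s ↔
    ∃ v : List LocCase, s = v ++ₛ Stream'.cycle blockB blockB_ne_nil := by
  constructor
  · rintro ⟨K, hK⟩
    refine ⟨s.take K, ?_⟩
    have : s.drop K = Stream'.cycle blockB blockB_ne_nil := by
      funext n
      rw [cycle_blockB]
      exact hK _ (Nat.le_add_left _ _)
    rw [← this, Stream'.append_take_drop]
  · rintro ⟨u, hu⟩
    refine ⟨u.length, fun k hk => ?_⟩
    obtain ⟨n, rfl⟩ := Nat.exists_eq_add_of_le hk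
    rw [hu, append_stream_apply, cycle_blockB]

theorem ChainData.prev_iii (h : ChainData x s w) {k : ℕ} (hk : s (k + 1) = .iii) : s k = .i := by
  cases hs : s k with
  | i => rfl
  | ii => exact absurd hk (h.next_ii k hs).1
  | iii => exact absurd hk (h.next_iii k hs).1

theorem ChainData.exists_i (h : ChainData x s w) (hB : ¬ EventuallyB s) (N : ℕ) :
    ∃ k, N ≤ k ∧ s k = .i := by
  by_contra! hn
  refine hB ⟨N + 1, fun k hk => ?_⟩
  obtain ⟨k, rfl⟩ := Nat.exists_eq_add_of_le' (show 1 ≤ k by omega)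
  cases hs : s (k + 1) with
  | i => exact absurd hs (hn _ (by omega))
  | ii => rfl
  | iii => exact absurd (h.prev_iii hs) (hn _ (by omega))

/-- The last place before `k` with a given property. -/
theorem exists_last_lt {P : ℕ → Prop} {k₀ k : ℕ} (hlt : k₀ < k) (h0 : P k₀) :
    ∃ k', k₀ ≤ k' ∧ k' < k ∧ P k' ∧ ∀ j, k' < j → j < k → ¬ P j := by
  classical
  have h1 := Nat.findGreatest_spec (P := P) (n := k - 1) (show k₀ ≤ k - 1 by omega) h0
  have h2 := Nat.le_findGreatest (P := P) (n := k - 1) (show k₀ ≤ k - 1 by omega) h0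
  have h3 := Nat.findGreatest_le (P := P) (k - 1)
  exact ⟨_, h2, by omega, h1, fun j hj hj' => Nat.findGreatest_is_greatest hj (by omega)⟩

theorem ChainData.w_mono (h : ChainData x s w) : Monotone w := by
  refine monotone_nat_of_le_succ fun k => ?_
  have := q_pos k
  cases hs : s k with
  | i => exact (h.next_i k hs).2.ge
  | ii => rw [(h.next_ii k hs).2]; omega
  | iii => exact (h.next_iii k hs).2.ge

/-- Complementary to `ChainData.w_mono`: at (ii) both terms grow by `q k`, at the other cases only
`q` grows. -/
theorem ChainData.gap_mono (h : ChainData x s w) : Monotone fun k => q (k + 1) - w k := by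
  refine monotone_nat_of_le_succ fun k => ?_
  have := q_pos k
  have e : q (k + 1 + 1) = q (k + 1) + q k := q_add_two k
  simp only [e]
  cases hs : s k with
  | i => rw [(h.next_i k hs).2]; omega
  | ii => rw [(h.next_ii k hs).2]; omega
  | iii => rw [(h.next_iii k hs).2]; omega

theorem ChainData.w_eq (h : ChainData x s w) {a b : ℕ} (hab : a ≤ b)
    (hne : ∀ j, a ≤ j → j < b → s j ≠ .ii) : w b = w a := by
  induction b, hab using Nat.le_induction with
  | base => rfl
  | succ b hab ih =>
    rw [← ih fun j hj hj' => hne j hj (by omega)]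
    cases hs : s b with
    | i => exact (h.next_i b hs).2
    | ii => exact absurd hs (hne b hab (by omega))
    | iii => exact (h.next_iii b hs).2

theorem ChainData.gap_eq (h : ChainData x s w) {a b : ℕ} (hab : a ≤ b)
    (hne : ∀ j, a ≤ j → j < b → s j = .ii) : q (b + 1) - w b = q (a + 1) - w a := by
  induction b, hab using Nat.le_induction with
  | base => rfl
  | succ b hab ih =>
    rw [← ih fun j hj hj' => hne j hj (by omega)]
    rw [(h.next_ii b (hne b hab (by omega))).2, show b + 1 + 1 = b + 2 from rfl, q_add_two]
    ring

/-- Between two consecutive letters `b` there is an `a`-chain. -/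
theorem ChainData.aChain_of_run (h : ChainData x s w) {k' k : ℕ} (hlt : k' < k) (hk' : s k' = .ii)
    (hk : s k = .ii) (hne : ∀ j, k' < j → j < k → s j ≠ .ii) :
    ∃ m, k = k' + 1 + 2 * m ∧ (1 ≤ m → IsAChain s m k') := by
  rcases Nat.eq_or_lt_of_le (Nat.succ_le_of_lt hlt) with e | hlt2
  · exact ⟨0, by omega, fun h => absurd h (by simp)⟩
  · have hi : s (k' + 1) = .i := by
      have h1 := (h.next_ii k' hk').1
      have h2 := hne (k' + 1) (by omega) hlt2
      cases h5 : s (k' + 1) <;> simp_all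
    obtain ⟨m, hm⟩ := Nat.even_or_odd' (k - (k' + 1))
    rcases hm with hm | hm
    · have e : k = k' + 1 + 2 * m := by omega
      refine ⟨m, e, fun h1 => isAChain_iff.2 ⟨h1, hk', fun j hj => ?_, e ▸ hk⟩⟩
      have := h.alternate (m := m) hi (fun j hj hj' => hne j (by omega) (by omega)) j hj
      refine ⟨this.1, ?_⟩
      rw [← this.2]; congr 1; omega
    · exfalso
      cases m with
      | zero =>
        have e : k = k' + 1 + 1 := by omega
        have := (h.next_i _ hi).1
        rw [← e, hk] at this
        simp at this
      | succ m =>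
        have h1 := (h.alternate (m := m + 1) hi (fun j hj hj' => hne j (by omega) (by omega)) m
          (by omega)).2
        have h2 : s (k' + 1 + 2 * m + 1 + 1) = .i := by
          have h3 := (h.next_iii _ h1).1
          have h4 := hne (k' + 1 + 2 * m + 1 + 1) (by omega) (by omega)
          cases h5 : s (k' + 1 + 2 * m + 1 + 1) <;> simp_all
        have h3 := (h.next_i _ h2).1
        rw [show k' + 1 + 2 * m + 1 + 1 + 1 = k by omega, hk] at h3
        simp at h3

/-- A letter `i` preceded by a run of letters `ii` ends a `b`-chain. -/
theorem ChainData.bChain_of_run (h : ChainData x s w) {k' l : ℕ} (hk' : s (k' + 1) ≠ .ii)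
    (hl : 1 ≤ l) (hk : s (k' + 2 + l) = .i) (hrun : ∀ j < l, s (k' + 2 + j) = .ii) :
    IsBChain s l k' := by
  have h1 : s (k' + 1) = .iii := by
    cases hs : s (k' + 1) with
    | i =>
      have h2 := (h.next_i _ hs).1
      have h3 := hrun 0 (by omega)
      simp only [add_zero] at h3
      rw [show k' + 1 + 1 = k' + 2 from rfl, h3] at h2
      simp at h2
    | ii => exact absurd hs hk'
    | iii => rfl
  refine isBChain_iff.2 ⟨hl, h.prev_iii h1, h1, hrun, hk, ?_⟩
  rw [← (h.next_i _ hk).1]; congr 1; omega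

/-! ### Growth of `q` and the effect of short chains -/

theorem q_succ_le (k : ℕ) : q (k + 1) ≤ 2 * q k := by
  cases k with
  | zero => decide
  | succ k => have := q_add_two k; have := q_le_succ k; rw [show k + 1 + 1 = k + 2 from rfl]; omega

theorem q_add_le (k m : ℕ) : q (k + m) ≤ 2 ^ m * q k := by
  induction m with
  | zero => simp
  | succ m ih =>
    have := q_succ_le (k + m)
    rw [pow_succ, ← add_assoc]; linarith

theorem le_q_add (k m : ℕ) : 2 ^ m * q k ≤ q (k + 2 * m) := by
  induction m with
  | zero => simp
  | succ m ih =>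
    have h1 := q_add_two (k + 2 * m)
    have h2 := q_le_succ (k + 2 * m)
    rw [pow_succ, show k + 2 * (m + 1) = k + 2 * m + 2 by ring]; linarith

theorem q_mono : Monotone q := monotone_nat_of_le_succ q_le_succ

/-- If all `a`-chains and `b`-chains are eventually shorter than `d`, the lengths `w k` stay away
from the extreme values. -/
theorem ChainData.bounds_of_short (h : ChainData x s w) {d P : ℕ} (hA : ¬ EventuallyA s)
    (hB : ¬ EventuallyB s) (ha : ∀ p m, P ≤ p → IsAChain s m p → m < d)
    (hb : ∀ p l, P ≤ p → IsBChain s l p → l < d) :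
    ∃ K, ∀ k, K ≤ k → (s k = .ii → q (k + 1) ≤ 2 ^ (2 * d + 3) * w k) ∧
      (s k = .iii → q k ≤ 2 ^ (2 * d + 3) * (q k - w k)) := by
  obtain ⟨k₁, hk₁, hs₁⟩ : ∃ k, P ≤ k ∧ s k = .ii := by
    by_contra! hn; exact hA ⟨P, hn⟩
  obtain ⟨k₂, hk₂, hs₂⟩ : ∃ k, P + 1 ≤ k ∧ s k ≠ .ii := by
    by_contra! hn; exact hB ⟨P + 1, hn⟩
  refine ⟨k₁ + k₂ + 2, fun k hk => ⟨fun hs => ?_, fun hs => ?_⟩⟩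
  · obtain ⟨k', h1, h2, h3, h4⟩ := exists_last_lt (P := fun j => s j = .ii)
      (show k₁ < k by omega) hs₁
    obtain ⟨m, rfl, hm⟩ := h.aChain_of_run h2 h3 hs h4
    have hmd : m ≤ d := by
      by_contra! hlt
      have := ha k' m (by omega) (hm (by omega))
      omega
    -- The last b before `k` added `q k'` to `w`, and at most 2d + 1 levels have passed since;
    -- doubling at each level accounts for the constant.
    have h5 := h.w_mono (show k' + 1 ≤ k' + 1 + 2 * m by omega)
    rw [(h.next_ii k' h3).2] at h5
    have h6 := h.pos k'
    have h7 := q_add_le k' (2 * d + 3)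
    have h8 : q (k' + 1 + 2 * m + 1) ≤ q (k' + (2 * d + 3)) := q_mono (by omega)
    calc q (k' + 1 + 2 * m + 1) ≤ 2 ^ (2 * d + 3) * q k' := h8.trans h7
      _ ≤ _ := by gcongr; omega
  · obtain ⟨k, rfl⟩ := Nat.exists_eq_add_of_le' (show 1 ≤ k by omega)
    have hi := h.prev_iii hs
    rw [(h.next_i k hi).2]
    obtain ⟨k', h1, h2, h3, h4⟩ := exists_last_lt (P := fun j => s j ≠ .ii)
      (show k₂ < k by omega) hs₂
    obtain ⟨k', rfl⟩ := Nat.exists_eq_add_of_le' (show 1 ≤ k' by omega)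
    obtain ⟨l, rfl⟩ := Nat.exists_eq_add_of_le (show k' + 2 ≤ k by omega)
    have hld : l ≤ d := by
      by_contra! hlt
      have := hb k' l (by omega) (h.bChain_of_run h3 (by omega) hi fun j hj =>
        not_not.1 (h4 _ (by omega) (by omega)))
      omega
    have h5 := h.gap_mono (show k' + 1 + 1 ≤ k' + 2 + l by omega)
    simp only at h5
    -- A level that is not (ii) opens a gap of at least `q (k'+1)`, and the gap never shrinks
    -- afterwards.
    have h6 : q (k' + 1) ≤ q (k' + 1 + 1 + 1) - w (k' + 1 + 1) := by
      have e1 : q (k' + 1 + 1 + 1) = q (k' + 1 + 1) + q (k' + 1) := q_add_two (k' + 1)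
      have e2 := q_le_succ (k' + 1)
      cases hs' : s (k' + 1) with
      | i => rw [(h.next_i _ hs').2]; have := h.le (k' + 1); omega
      | ii => exact absurd hs' h3
      | iii => rw [(h.next_iii _ hs').2]; have := h.le_iii (k' + 1) hs'; omega
    have h7 := q_add_le (k' + 1) (2 * d + 3)
    have h8 : q (k' + 2 + l + 1) ≤ q (k' + 1 + (2 * d + 3)) := q_mono (by omega)
    calc q (k' + 2 + l + 1) ≤ 2 ^ (2 * d + 3) * q (k' + 1) := h8.trans h7
      _ ≤ _ := by gcongr; omega

theorem abs_q_sub_phi_mul (k : ℕ) : |(q k : ℝ) - phi * q (k + 1)| ≤ 1 := by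
  have h0 := half_lt_phi
  have h1 := phi_lt
  -- The recurrence has the roots 1/φ and -φ; this combination cancels the growing one.
  have e : (q k : ℝ) - phi * q (k + 1) = phi ^ 2 * (-phi) ^ k := by
    induction k with
    | zero => simp only [zero_add, q_zero, q_one, phi_sq]; push_cast; ring
    | succ k ih =>
      rw [show q (k + 1 + 1) = q (k + 1) + q k from q_add_two k, pow_succ (-phi), ← mul_assoc, ← ih]
      push_cast
      linear_combination (-(q (k + 1) : ℝ)) * phi_sq
  rw [e, abs_mul, abs_pow, abs_pow, abs_neg, abs_of_pos (by linarith : 0 < phi)]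
  exact mul_le_one₀ (pow_le_one₀ (by linarith) (by linarith)) (by positivity)
    (pow_le_one₀ (by linarith) (by linarith))

theorem phi_mul_q_le (k : ℕ) : phi * q (k + 1) ≤ q k + 1 := by
  linarith [(abs_le.1 (abs_q_sub_phi_mul k)).1]

theorem q_le_phi_mul (k : ℕ) : (q k : ℝ) ≤ phi * q (k + 1) + 1 := by
  linarith [(abs_le.1 (abs_q_sub_phi_mul k)).2]

theorem q_add_two_real (k : ℕ) : (q (k + 2) : ℝ) = q (k + 1) + q k := by
  rw [q_add_two]; push_cast; ring

theorem q_pos_real (k : ℕ) : (1 : ℝ) ≤ q k := by exact_mod_cast q_pos k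

theorem exists_forall_le_mul_q {ε : ℝ} (hε : 0 < ε) (C : ℝ) :
    ∃ K, ∀ k, K ≤ k → C ≤ ε * q k := by
  obtain ⟨K, hK⟩ := exists_nat_ge (C / ε)
  refine ⟨K, fun k hk => ?_⟩
  have h1 : (K : ℝ) ≤ k := by exact_mod_cast hk
  have h2 : (k : ℝ) ≤ q k := by exact_mod_cast natCast_le_q k
  have h3 := (div_le_iff₀ hε).1 hK
  nlinarith

theorem exists_q_le_lt {K : ℕ} {n : ℤ} (h : q K ≤ n) : ∃ k, K ≤ k ∧ q k ≤ n ∧ n < q (k + 1) := by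
  by_contra! hc
  have : ∀ k, K ≤ k → q k ≤ n := by
    intro k hk
    induction k, hk using Nat.le_induction with
    | base => exact h
    | succ k hk ih => exact hc k hk ih
  have hn : 0 ≤ n := by have := q_pos K; omega
  have h1 := this (K + (n + 1).toNat) (by omega)
  have h2 := natCast_le_q (K + (n + 1).toNat)
  push_cast at h2
  omega

/-! ### Transfer of estimates on `r` to `rep` -/

theorem le_rep_of_eventually {c : ℝ} (N : ℕ) (h : ∀ n, N ≤ n → c ≤ (r n x : ℝ) / n) :
    (c : EReal) ≤ rep x := by
  refine le_liminf_of_le (by isBoundedDefault) ?_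
  filter_upwards [eventually_ge_atTop N] with n hn
  exact EReal.coe_le_coe_iff.2 (h n hn)

theorem rep_le_of_frequently {c : ℝ} (h : ∀ N, ∃ n, N ≤ n ∧ (r n x : ℝ) / n ≤ c) :
    rep x ≤ (c : EReal) := by
  refine liminf_le_of_frequently_le' ?_
  rw [frequently_atTop]
  intro N
  obtain ⟨n, hn, hc⟩ := h N
  exact ⟨n, hn, EReal.coe_le_coe_iff.2 hc⟩

theorem le_rep_of_forall_lt {μ : ℝ} (hμ : 0 < μ)
    (h : ∀ l, 0 < l → l < μ → ((1 + l : ℝ) : EReal) ≤ rep x) : ((1 + μ : ℝ) : EReal) ≤ rep x := by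
  by_contra! hlt
  -- The maximum with 1 keeps `z - 1` positive, as the hypothesis requires.
  have h1 : max (rep x) ((1 : ℝ) : EReal) < ((1 + μ : ℝ) : EReal) :=
    max_lt hlt (EReal.coe_lt_coe_iff.2 (by linarith))
  obtain ⟨z, hz1, hz2⟩ := EReal.lt_iff_exists_real_btwn.1 h1
  have hz3 : 1 < z := EReal.coe_lt_coe_iff.1 ((le_max_right _ _).trans_lt hz1)
  have hz4 : z < 1 + μ := EReal.coe_lt_coe_iff.1 hz2
  have := h (z - 1) (by linarith) (by linarith)
  rw [add_sub_cancel] at this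
  exact absurd (this.trans (le_max_left _ _)) (not_le.2 hz1)

theorem rep_le_of_forall_gt {μ : ℝ}
    (h : ∀ ε, 0 < ε → ε ≤ 1 / 2 → rep x ≤ ((μ + ε : ℝ) : EReal)) : rep x ≤ (μ : EReal) := by
  by_contra! hlt
  obtain ⟨z, hz1, hz2⟩ := EReal.lt_iff_exists_real_btwn.1 hlt
  have hz3 : μ < z := EReal.coe_lt_coe_iff.1 hz1
  have h1 := h (min (z - μ) (1 / 2)) (lt_min (by linarith) (by norm_num)) (min_le_right _ _)
  have h2 : μ + min (z - μ) (1 / 2) ≤ z := by linarith [min_le_left (z - μ) (1 / 2)]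
  exact absurd (h1.trans (EReal.coe_le_coe_iff.2 h2)) (not_le.2 hz2)

/-- Lower bound for `rep x` from bounds at each level. -/
theorem ChainData.le_rep (h : ChainData x s w) {l : ℝ} (hl : 0 < l) (K : ℕ)
    (hK : ∀ k, K ≤ k → l * q (k + 2) ≤ q (k + 1) ∧ (s k = .ii → l * q (k + 2) ≤ w k + q k) ∧
      (s k = .iii → l * (w k + q (k + 1)) ≤ q k)) : ((1 + l : ℝ) : EReal) ≤ rep x := by
  refine le_rep_of_eventually ((q (K + 1)).toNat) fun n hn => ?_
  have hq := q_pos (K + 1)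
  -- The shift to n + 1 matches the threshold `q (k+1) - 1 ≤ n` of the lower bounds; the index is
  -- then lowered by one.
  obtain ⟨k, hk, h1, h2⟩ := exists_q_le_lt (K := K + 1) (n := (n : ℤ) + 1) (by omega)
  obtain ⟨k, rfl⟩ := Nat.exists_eq_add_of_le' (show 1 ≤ k by omega)
  obtain ⟨b1, b2, b3⟩ := hK k (by omega)
  have hn0 : (0 : ℝ) < n := by
    have : 0 < n := by omega
    exact_mod_cast this
  have hnq : (n : ℝ) ≤ q (k + 2) := by
    have : (n : ℤ) ≤ q (k + 2) := by rw [show k + 2 = k + 1 + 1 from rfl]; omega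
    exact_mod_cast this
  suffices l * n ≤ (((r n x : ℤ) - n : ℤ) : ℝ) by
    push_cast at this
    rw [le_div_iff₀ hn0]; linarith
  have hln : l * n ≤ l * q (k + 2) := by gcongr
  cases hs : s k with
  | i =>
    have := h.lower_i k n hs (by omega)
    have : (q (k + 1) : ℝ) ≤ (((r n x : ℤ) - n : ℤ) : ℝ) := by exact_mod_cast this
    linarith
  | ii =>
    rcases h.lower_ii k n hs (by omega) with h3 | ⟨h3, -⟩
    · have : ((w k + q k : ℤ) : ℝ) ≤ (((r n x : ℤ) - n : ℤ) : ℝ) := by exact_mod_cast h3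
      have := b2 hs
      push_cast at *
      linarith
    · have : (q (k + 1) : ℝ) ≤ (((r n x : ℤ) - n : ℤ) : ℝ) := by exact_mod_cast h3
      linarith
  | iii =>
    rcases h.lower_iii k n hs (by omega) with h3 | ⟨h3, h4⟩
    · have hw := h.pos k
      have : (q (k + 1) : ℝ) ≤ (((r n x : ℤ) - n : ℤ) : ℝ) := by
        have : q (k + 1) ≤ (r n x : ℤ) - n := by omega
        exact_mod_cast this
      linarith
    · have : (q k : ℝ) ≤ (((r n x : ℤ) - n : ℤ) : ℝ) := by exact_mod_cast h3
      have h5 : (n : ℝ) ≤ w k + q (k + 1) := by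
        have : (n : ℤ) ≤ w k + q (k + 1) := by omega
        exact_mod_cast this
      have h6 : l * n ≤ l * (w k + q (k + 1)) := by gcongr
      linarith [b3 hs]

/-- Upper bound for `rep x` from infinitely many early repeats. -/
theorem rep_le_of_repeats {l : ℝ} (h : ∀ N : ℕ, ∃ (n : ℕ) (m : ℤ), N ≤ n ∧ 1 ≤ n ∧
      (r n x : ℤ) - n ≤ m ∧ (m : ℝ) ≤ l * n) : rep x ≤ ((1 + l : ℝ) : EReal) := by
  refine rep_le_of_frequently fun N => ?_
  obtain ⟨n, m, hn, h1, h2, h3⟩ := h N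
  refine ⟨n, hn, ?_⟩
  have hn0 : (0 : ℝ) < n := by exact_mod_cast h1
  rw [div_le_iff₀ hn0]
  have : (((r n x : ℤ) - n : ℤ) : ℝ) ≤ m := by exact_mod_cast h2
  push_cast at this
  linarith

theorem ChainData.rep_le_i (h : ChainData x s w) {l : ℝ}
    (hl : ∀ N, ∃ k, N ≤ k ∧ s k = .i ∧ (q (k + 1) : ℝ) ≤ l * (w k + q (k + 2) - 2)) :
    rep x ≤ ((1 + l : ℝ) : EReal) := by
  refine rep_le_of_repeats fun N => ?_
  obtain ⟨k, hk, hs, hle⟩ := hl (N + 1)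
  have h1 := natCast_le_q (k + 2)
  have h2 := h.pos k
  push_cast at h1
  obtain ⟨n, hn⟩ := Int.eq_ofNat_of_zero_le (show 0 ≤ w k + q (k + 2) - 2 by omega)
  refine ⟨n, q (k + 1), by omega, by omega, h.upper_i k n hs hn.symm, ?_⟩
  have : ((w k + q (k + 2) - 2 : ℤ) : ℝ) = n := by exact_mod_cast hn
  push_cast at this
  rwa [← this]

theorem ChainData.rep_le_ii (h : ChainData x s w) {l : ℝ}
    (hl : ∀ N, ∃ k, N ≤ k ∧ s k = .ii ∧ (w k + q k : ℝ) ≤ l * (q (k + 2) - 2)) :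
    rep x ≤ ((1 + l : ℝ) : EReal) := by
  refine rep_le_of_repeats fun N => ?_
  obtain ⟨k, hk, hs, hle⟩ := hl (N + 1)
  have h1 := natCast_le_q (k + 2)
  push_cast at h1
  obtain ⟨n, hn⟩ := Int.eq_ofNat_of_zero_le (show 0 ≤ q (k + 2) - 2 by omega)
  refine ⟨n, w k + q k, by omega, by omega, h.upper_ii k n hs hn.symm, ?_⟩
  have : ((q (k + 2) - 2 : ℤ) : ℝ) = n := by exact_mod_cast hn
  push_cast at this ⊢
  rwa [← this]

/-! ### The extreme values of `rep` -/

theorem muMin_le_rep (h : ChainData x s w) : ((muMin : ℝ) : EReal) ≤ rep x := by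
  have h0 := half_lt_phi
  have h1 := phi_lt
  refine le_rep_of_forall_lt (by positivity) fun l hl hlt => ?_
  obtain ⟨K, hK⟩ := exists_forall_le_mul_q (sub_pos.2 hlt) 2
  refine h.le_rep hl K fun k hk => ?_
  have a1 := phi_mul_q_le k
  have a2 := phi_mul_q_le (k + 1)
  have a3 := hK (k + 2) (by omega)
  -- In all three cases the ratio is at least `q k / q (k+2)`, which tends to φ²; in (iii) this uses
  -- `w k ≤ q k`.
  have a4 : phi ^ 2 * q (k + 2) ≤ q k + 2 := by nlinarith
  have a5 : l * q (k + 2) ≤ q k := by linarith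
  have a6 : (q k : ℝ) ≤ q (k + 1) := by exact_mod_cast q_le_succ k
  refine ⟨a5.trans a6, fun _ => ?_, fun hs => ?_⟩
  · have : (1 : ℝ) ≤ w k := by exact_mod_cast h.pos k
    linarith
  · have : (w k : ℝ) ≤ q k := by exact_mod_cast h.le_iii k hs
    have h3 : l * (w k + q (k + 1)) ≤ l * q (k + 2) := by
      rw [q_add_two_real]
      exact mul_le_mul_of_nonneg_left (by linarith) hl.le
    linarith

theorem rep_le_muMax (h : ChainData x s w) : rep x ≤ ((muMax : ℝ) : EReal) := by
  have h0 := half_lt_phi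
  have h1 := phi_lt
  refine rep_le_of_forall_gt fun ε hε _ => ?_
  rw [show muMax + ε = 1 + (phi + ε) by unfold muMax; ring]
  -- If only (ii) remains, the constant gap makes the prefix repeat of period `q (k+1)` almost `q
  -- (k+2)` long; otherwise the repeats at the infinitely many (i) do.
  by_cases hB : EventuallyB s
  · obtain ⟨K, hK⟩ := hB
    obtain ⟨C, hC⟩ : ∃ C : ℝ, C = q (K + 1) - w K := ⟨_, rfl⟩
    obtain ⟨K', hK'⟩ := exists_forall_le_mul_q hε (1 + (phi + ε) * (C + 2))
    refine rep_le_of_repeats fun N => ?_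
    set k := K + K' + N + 2 with hk
    have e := h.gap_eq (show K ≤ k by omega) fun j hj _ => hK j hj
    have e2 := q_add_two k
    have e' : (q (k + 1) : ℝ) - w k = C := by rw [hC]; exact_mod_cast e
    have h2 := h.pos k
    have h3 := natCast_le_q k
    have h4 := q_pos k
    obtain ⟨n, hn⟩ := Int.eq_ofNat_of_zero_le (show 0 ≤ w k + q k - 2 by omega)
    refine ⟨n, q (k + 1), by omega, by omega, h.upper_ii' k n (hK k (by omega)) hn.symm, ?_⟩
    have hn' : ((w k + q k - 2 : ℤ) : ℝ) = n := by exact_mod_cast hn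
    push_cast at hn'
    have a1 := q_le_phi_mul (k + 1)
    have a2 := hK' (k + 2) (by omega)
    have a3 := q_add_two_real k
    rw [← hn', show (w k : ℝ) + q k - 2 = q (k + 2) - (C + 2) by linarith]
    linarith
  · obtain ⟨K, hK⟩ := exists_forall_le_mul_q hε (1 + (phi + ε) * 1)
    refine h.rep_le_i fun N => ?_
    obtain ⟨k, hk, hs⟩ := h.exists_i hB (N + K)
    refine ⟨k, by omega, hs, ?_⟩
    have a1 := q_le_phi_mul (k + 1)
    have a2 := hK (k + 2) (by omega)
    have a3 : (1 : ℝ) ≤ w k := by exact_mod_cast h.pos k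
    have a4 : (phi + ε) * (q (k + 2) - 1) ≤ (phi + ε) * (w k + q (k + 2) - 2) := by
      gcongr ?_ * ?_; linarith
    linarith

theorem muMax_le_rep (h : ChainData x s w) (hAB : EventuallyA s ∨ EventuallyB s) :
    ((muMax : ℝ) : EReal) ≤ rep x := by
  have h0 := half_lt_phi
  have h1 := phi_lt
  refine le_rep_of_forall_lt (by positivity) fun l hl hlt => ?_
  rcases hAB with ⟨K, hK⟩ | ⟨K, hK⟩
  · obtain ⟨K', hK'⟩ := exists_forall_le_mul_q (sub_pos.2 hlt) (1 + l * w K)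
    refine h.le_rep hl (K + K') fun k hk => ?_
    have a1 := phi_mul_q_le k
    have a2 := phi_mul_q_le (k + 1)
    have a3 := hK' (k + 1) (by omega)
    have a4 := hK' (k + 2) (by omega)
    have a5 : (1 : ℝ) ≤ w K := by exact_mod_cast h.pos K
    have e := h.w_eq (show K ≤ k by omega) fun j hj _ => hK j hj
    refine ⟨by nlinarith, fun hs => absurd hs (hK k (by omega)), fun _ => ?_⟩
    rw [e]; linarith
  · obtain ⟨K', hK'⟩ := exists_forall_le_mul_q (sub_pos.2 hlt) (1 + (q (K + 1) - w K))
    refine h.le_rep hl (K + K') fun k hk => ?_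
    have a2 := phi_mul_q_le (k + 1)
    have a4 := hK' (k + 2) (by omega)
    have e := h.gap_eq (show K ≤ k by omega) fun j hj _ => hK j hj
    have e' : (q (k + 1) : ℝ) - w k = q (K + 1) - w K := by exact_mod_cast e
    have a5 : (w K : ℝ) ≤ q (K + 1) := by exact_mod_cast h.le K
    have a6 := q_add_two_real k
    have a7 := q_pos_real (k + 2)
    refine ⟨by linarith, fun _ => by nlinarith, fun hs => ?_⟩
    rw [hK k (by omega)] at hs
    simp at hs

theorem ChainData.exists_i_iii_ii (h : ChainData x s w) (hA : ¬ EventuallyA s)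
    (hB : ¬ EventuallyB s) (N : ℕ) :
    ∃ k, N ≤ k ∧ s k = .i ∧ s (k + 1) = .iii ∧ s (k + 2) = .ii := by
  obtain ⟨k₁, hk₁, h1⟩ := h.exists_i hB N
  obtain ⟨k₂, hk₂, h2⟩ : ∃ k, k₁ + 2 ≤ k ∧ s k = .ii := by
    by_contra! hn; exact hA ⟨_, hn⟩
  obtain ⟨k, e1, e2, e3, e4⟩ := exists_last_lt (P := fun j => s j ≠ .ii)
    (show k₁ < k₂ by omega) (by simp [h1])
  have h3 : s (k + 1) = .ii := by
    rcases Nat.eq_or_lt_of_le (Nat.succ_le_of_lt e2) with e | e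
    · rw [← h2, ← e]
    · exact not_not.1 (e4 _ (Nat.lt_succ_self k) e)
  have h4 : s k = .iii := by
    cases hs : s k with
    | i => rw [(h.next_i k hs).1] at h3; simp at h3
    | ii => exact absurd hs e3
    | iii => rfl
  have hne : k ≠ k₁ := by rintro rfl; rw [h1] at h4; simp at h4
  obtain ⟨k, rfl⟩ := Nat.exists_eq_add_of_le' (show 1 ≤ k by omega)
  exact ⟨k, by omega, h.prev_iii h4, h4, h3⟩

/-- Consider (i)(iii)(ii) starting at `k`, which recurs forever. If `w k` is at least half of `q
(k+1)`, the repeat at (i) is long, with ratio near 0.47; if not, `w (k+2) = w k` is small and the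
repeat at (ii) has ratio at most about 1/2. -/
theorem rep_lt_muMax (h : ChainData x s w) (hA : ¬ EventuallyA s) (hB : ¬ EventuallyB s) :
    rep x < ((muMax : ℝ) : EReal) := by
  have h0 := half_lt_phi
  have h1 := phi_lt
  suffices rep x ≤ ((1 + 11 / 20 : ℝ) : EReal) from
    this.trans_lt (EReal.coe_lt_coe_iff.2 (by unfold muMax; linarith))
  obtain ⟨K, hK⟩ := exists_forall_le_mul_q (show (0 : ℝ) < 1 / 100 by norm_num) 10
  refine rep_le_of_repeats fun N => ?_
  obtain ⟨k, hk, s0, s1, s2⟩ := h.exists_i_iii_ii hA hB (N + K + 1)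
  have w1 := (h.next_i k s0).2
  have w2 := (h.next_iii _ s1).2
  rw [w1] at w2
  have hw := h.pos k
  have q2 := natCast_le_q (k + 2)
  have q4 := natCast_le_q (k + 2 + 2)
  push_cast at q2 q4
  have a1 := q_le_phi_mul (k + 1)
  have a2 := hK (k + 1) (by omega)
  have a3 := hK (k + 2) (by omega)
  have a4 := q_add_two_real (k + 1)
  have a5 := q_add_two_real (k + 2)
  have a6 := q_pos_real (k + 2)
  by_cases hc : q (k + 1) ≤ 2 * w k
  · obtain ⟨n, hn⟩ := Int.eq_ofNat_of_zero_le (show 0 ≤ w k + q (k + 2) - 2 by omega)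
    refine ⟨n, q (k + 1), by omega, by omega, h.upper_i k n s0 hn.symm, ?_⟩
    have : ((w k + q (k + 2) - 2 : ℤ) : ℝ) = n := by exact_mod_cast hn
    push_cast at this
    have hc' : (q (k + 1) : ℝ) ≤ 2 * w k := by exact_mod_cast hc
    rw [← this]
    nlinarith
  · obtain ⟨n, hn⟩ := Int.eq_ofNat_of_zero_le (show 0 ≤ q (k + 2 + 2) - 2 by omega)
    refine ⟨n, w k + q (k + 2), by omega, by omega, ?_, ?_⟩
    · have := h.upper_ii (k + 2) n s2 hn.symm
      rwa [w2] at this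
    have : ((q (k + 2 + 2) - 2 : ℤ) : ℝ) = n := by exact_mod_cast hn
    push_cast at this
    have hc' : 2 * (w k : ℝ) < q (k + 1) := by exact_mod_cast not_le.1 hc
    rw [← this]
    push_cast
    simp only [show k + 1 + 2 = k + 3 from rfl, show k + 1 + 1 = k + 2 from rfl] at *
    linarith

theorem muMin_lt_muMax : muMin < muMax := by
  have h0 := half_lt_phi
  unfold muMin muMax
  linarith [phi_sq]

/-- If both sorts of chains are eventually short, `rep x` is bounded away from `muMin`. -/
theorem muMin_lt_rep (h : ChainData x s w) {d P : ℕ}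
    (ha : ∀ p m, P ≤ p → IsAChain s m p → m < d) (hb : ∀ p l, P ≤ p → IsBChain s l p → l < d) :
    ((muMin : ℝ) : EReal) < rep x := by
  have h0 := half_lt_phi
  have h1 := phi_lt
  have hsq := phi_sq
  by_cases hA : EventuallyA s
  · exact (EReal.coe_lt_coe_iff.2 muMin_lt_muMax).trans_le (muMax_le_rep h (Or.inl hA))
  by_cases hB : EventuallyB s
  · exact (EReal.coe_lt_coe_iff.2 muMin_lt_muMax).trans_le (muMax_le_rep h (Or.inr hB))
  obtain ⟨K, hK⟩ := h.bounds_of_short hA hB ha hb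
  obtain ⟨D, hD⟩ : ∃ D : ℝ, D = (2 ^ (2 * d + 3))⁻¹ := ⟨_, rfl⟩
  have hD0 : 0 < D := by rw [hD]; positivity
  have hD1 : D ≤ 1 := by rw [hD]; exact inv_le_one_of_one_le₀ (one_le_pow₀ (by norm_num))
  have hmul : (2 : ℝ) ^ (2 * d + 3) * D = 1 := by rw [hD]; exact mul_inv_cancel₀ (by positivity)
  obtain ⟨K', hK'⟩ := exists_forall_le_mul_q (show (0 : ℝ) < D / 100 by positivity) 10
  -- The gain D/20 is modest: (ii) leaves room for about D/2 and (iii) for at least about (9/25)² D,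
  -- where 9/25 bounds φ² from below; bounded terms are absorbed by `hK'`.
  refine lt_of_lt_of_le (EReal.coe_lt_coe_iff.2 (?_ : muMin < 1 + (phi ^ 2 + D / 20)))
    (h.le_rep (by positivity) (K + K') fun k hk => ?_)
  · unfold muMin; linarith
  have a1 := phi_mul_q_le k
  have a2 := phi_mul_q_le (k + 1)
  have a3 := hK' (k + 2) (by omega)
  have a4 : phi ^ 2 * q (k + 2) ≤ q k + 2 := by nlinarith
  have a5 := q_add_two_real k
  have a6 : (q k : ℝ) ≤ q (k + 1) := by exact_mod_cast q_le_succ k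
  have a7 := q_pos_real (k + 2)
  simp only [show k + 1 + 1 = k + 2 from rfl] at *
  obtain ⟨b1, b2⟩ := hK k (by omega)
  refine ⟨?_, fun hs => ?_, fun hs => ?_⟩
  · have : (phi ^ 2 + D / 20) * q (k + 2) ≤ (1 / 2) * q (k + 2) := by
      gcongr; linarith
    nlinarith
  · have b3 : (q (k + 1) : ℝ) ≤ 2 ^ (2 * d + 3) * w k := by exact_mod_cast b1 hs
    have b4 : D * q (k + 1) ≤ w k := by
      calc D * q (k + 1) ≤ D * (2 ^ (2 * d + 3) * w k) := by gcongr
        _ = (2 ^ (2 * d + 3) * D) * w k := by ring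
        _ = w k := by rw [hmul, one_mul]
    have b5 : D * (1 / 2 * q (k + 2)) ≤ D * q (k + 1) := by
      gcongr; linarith
    linarith
  · have b3 : (q k : ℝ) ≤ 2 ^ (2 * d + 3) * (q k - w k) := by exact_mod_cast b2 hs
    have b4 : D * q k ≤ q k - w k := by
      calc D * q k ≤ D * (2 ^ (2 * d + 3) * (q k - w k)) := by gcongr
        _ = (2 ^ (2 * d + 3) * D) * (q k - w k) := by ring
        _ = q k - w k := by rw [hmul, one_mul]
    have b5 : (9 / 25) * (q (k + 2) : ℝ) ≤ q k + 2 := by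
      have : (9 / 25 : ℝ) ≤ phi ^ 2 := by linarith
      nlinarith
    have b6 : D * ((9 / 25) * q (k + 2) - 2) ≤ D * q k := by gcongr; linarith
    have b7 : (w k : ℝ) + q (k + 1) ≤ q (k + 2) - D * ((9 / 25) * q (k + 2) - 2) := by linarith
    have b8 : (phi ^ 2 + D / 20) * (w k + q (k + 1)) ≤
        (phi ^ 2 + D / 20) * (q (k + 2) - D * ((9 / 25) * q (k + 2) - 2)) := by gcongr
    refine b8.trans ?_
    have b9 : 0 ≤ (9 / 25) * (q (k + 2) : ℝ) - 2 := by nlinarith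
    have b10 : (9 / 25) * (D * ((9 / 25) * q (k + 2) - 2)) ≤
        (phi ^ 2 + D / 20) * (D * ((9 / 25) * q (k + 2) - 2)) := by
      gcongr; linarith
    nlinarith

theorem exists_pow_inv_lt {ε : ℝ} (hε : 0 < ε) : ∃ m : ℕ, 1 ≤ m ∧ ((2 : ℝ) ^ m)⁻¹ < ε := by
  obtain ⟨m, hm⟩ := exists_pow_lt_of_lt_one hε (show (1 / 2 : ℝ) < 1 by norm_num)
  refine ⟨m + 1, by omega, lt_of_le_of_lt ?_ hm⟩
  rw [one_div, inv_pow]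
  gcongr <;> norm_num

/-- Arbitrarily long chains force `rep x ≤ muMin`. -/
theorem rep_le_muMin (h : ChainData x s w) (hS : ∀ d : ℕ, 1 ≤ d →
    {p : ℕ | ∃ m, d ≤ m ∧ IsAChain s m p}.Infinite ∨
    {p : ℕ | ∃ l, d ≤ l ∧ IsBChain s l p}.Infinite) : rep x ≤ ((muMin : ℝ) : EReal) := by
  have h0 := half_lt_phi
  have h1 := phi_lt
  have hsq := phi_sq
  refine rep_le_of_forall_gt fun ε hε hε' => ?_
  rw [show muMin + ε = 1 + (phi ^ 2 + ε) by unfold muMin; ring]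
  obtain ⟨m, hm1, hm⟩ := exists_pow_inv_lt (show 0 < ε / 4 by positivity)
  obtain ⟨K, hK⟩ := exists_forall_le_mul_q (show (0 : ℝ) < ε / 8 by positivity)
    (4 + 4 * (phi ^ 2 + ε))
  -- Two levels at least double `q`, so a b-chain of length 2m multiplies it by 2^m; an a-chain of
  -- that length spans more levels still.
  rcases hS (2 * m) (by omega) with hinf | hinf
  · refine h.rep_le_ii fun N => ?_
    obtain ⟨p, ⟨m', hm', hp⟩, hlt⟩ := hinf.exists_gt (N + K)
    obtain ⟨-, p1, p2, p3⟩ := isAChain_iff.1 hp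
    refine ⟨p + 1 + 2 * m', by omega, p3, ?_⟩
    have e := h.w_eq (show p + 1 ≤ p + 1 + 2 * m' by omega) fun j hj hj' => by
      obtain ⟨i, rfl⟩ := Nat.exists_eq_add_of_le hj
      rcases Nat.even_or_odd' i with ⟨i, rfl | rfl⟩
      · rw [(p2 i (by omega)).1]; simp
      · rw [show p + 1 + (2 * i + 1) = p + 2 + 2 * i by ring, (p2 i (by omega)).2]; simp
    obtain ⟨k, hk⟩ : ∃ k, k = p + 1 + 2 * m' := ⟨_, rfl⟩
    have g1 : 2 ^ m * w k ≤ q (k + 1) := by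
      rw [hk, e]
      calc 2 ^ m * w (p + 1) ≤ 2 ^ m * q (p + 1 + 1) := by gcongr; exact h.le (p + 1)
        _ ≤ q (p + 1 + 1 + 2 * m) := le_q_add _ _
        _ ≤ _ := q_mono (by omega)
    rw [← hk]
    have g2 : (2 : ℝ) ^ m * w k ≤ q (k + 1) := by exact_mod_cast g1
    have g3 : (w k : ℝ) ≤ ε / 4 * q (k + 1) := by
      calc (w k : ℝ) = (2 ^ m)⁻¹ * (2 ^ m * w k) := by
            rw [← mul_assoc, inv_mul_cancel₀ (by positivity), one_mul]
        _ ≤ (2 ^ m)⁻¹ * q (k + 1) := by gcongr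
        _ ≤ ε / 4 * q (k + 1) := by
            have := q_pos_real (k + 1)
            gcongr
    have a1 := q_le_phi_mul k
    have a2 := q_le_phi_mul (k + 1)
    have a3 := hK (k + 2) (by omega)
    have a4 : (q (k + 1) : ℝ) ≤ q (k + 2) := by exact_mod_cast q_le_succ (k + 1)
    have a5 : (q k : ℝ) ≤ phi ^ 2 * q (k + 2) + 2 := by nlinarith
    have a6 : ε / 4 * q (k + 1) ≤ ε / 4 * q (k + 2) := by gcongr
    nlinarith
  · refine h.rep_le_i fun N => ?_
    obtain ⟨p, ⟨l, hl, hp⟩, hlt⟩ := hinf.exists_gt (N + K)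
    obtain ⟨-, p1, p2, p3, p4, -⟩ := isBChain_iff.1 hp
    refine ⟨p + 2 + l, by omega, p4, ?_⟩
    have e := h.gap_eq (show p + 2 ≤ p + 2 + l by omega) fun j hj hj' => by
      obtain ⟨i, rfl⟩ := Nat.exists_eq_add_of_le hj
      exact p3 i (by omega)
    obtain ⟨k, hk⟩ : ∃ k, k = p + 2 + l := ⟨_, rfl⟩
    have g1 : 2 ^ m * (q (k + 1) - w k) ≤ q (k + 1) := by
      rw [hk, e]
      have := h.pos (p + 2)
      calc 2 ^ m * (q (p + 2 + 1) - w (p + 2)) ≤ 2 ^ m * q (p + 2 + 1) := by gcongr; omega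
        _ ≤ q (p + 2 + 1 + 2 * m) := le_q_add _ _
        _ ≤ _ := q_mono (by omega)
    rw [← hk]
    have g2 : (2 : ℝ) ^ m * (q (k + 1) - w k) ≤ q (k + 1) := by exact_mod_cast g1
    have g3 : (q (k + 1) : ℝ) - w k ≤ ε / 4 * q (k + 1) := by
      calc (q (k + 1) : ℝ) - w k = (2 ^ m)⁻¹ * (2 ^ m * (q (k + 1) - w k)) := by
            rw [← mul_assoc, inv_mul_cancel₀ (by positivity), one_mul]
        _ ≤ (2 ^ m)⁻¹ * q (k + 1) := by gcongr
        _ ≤ ε / 4 * q (k + 1) := by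
            have := q_pos_real (k + 1)
            gcongr
    have a1 := q_le_phi_mul (k + 1)
    have a2 := q_le_phi_mul (k + 2)
    have a3 := hK (k + 3) (by omega)
    have a4 : (q (k + 1) : ℝ) ≤ q (k + 3) := by exact_mod_cast q_mono (by omega)
    have a5 : (q (k + 1) : ℝ) ≤ phi ^ 2 * q (k + 3) + 2 := by
      simp only [show k + 1 + 1 = k + 2 from rfl, show k + 2 + 1 = k + 3 from rfl] at *
      nlinarith
    have a7 : (q (k + 3) : ℝ) = q (k + 2) + q (k + 1) := q_add_two_real (k + 1)
    have a8 : (w k : ℝ) + q (k + 2) - 2 = q (k + 3) - (q (k + 1) - w k) - 2 := by rw [a7]; ring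
    rw [a8]
    -- The restriction ε ≤ 1/2 makes the factor φ² + ε at most 1.
    have a9 : (phi ^ 2 + ε) * (q (k + 1) - w k) ≤ 1 * (ε / 4 * q (k + 3)) := by
      have h2 : (q (k + 1) : ℝ) - w k ≤ ε / 4 * q (k + 3) := g3.trans (by gcongr)
      have h3 : (w k : ℝ) ≤ q (k + 1) := by exact_mod_cast h.le k
      exact mul_le_mul (by linarith) h2 (by linarith) zero_le_one
    linarith

end SturmianRep

theorem mainTheorem2 (x : ℕ → Fin 2)
    (hx : SturmianRep.IsSturmianOfSlope SturmianRep.phi x) :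
    -- the locating chain is well defined: at each level exactly one case, with exactly one word
    (∀ k : ℕ, 1 ≤ k → ∃! p : SturmianRep.LocCase × List (Fin 2),
      SturmianRep.InCaseWith x k p.1 p.2) ∧
    ((SturmianRep.muMin : ℝ) : EReal) ≤ SturmianRep.rep x ∧
    SturmianRep.rep x ≤ ((SturmianRep.muMax : ℝ) : EReal) ∧
    (((∃ u : List SturmianRep.LocCase, SturmianRep.locatingChain x =
          u ++ₛ Stream'.cycle SturmianRep.blockA SturmianRep.blockA_ne_nil) ∨
      (∃ v : List SturmianRep.LocCase, SturmianRep.locatingChain x =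
          v ++ₛ Stream'.cycle SturmianRep.blockB SturmianRep.blockB_ne_nil)) ↔
      SturmianRep.rep x = ((SturmianRep.muMax : ℝ) : EReal)) ∧
    ((∀ d : ℕ, 1 ≤ d → x ∈ SturmianRep.S d) ↔
      SturmianRep.rep x = ((SturmianRep.muMin : ℝ) : EReal)) := by
  obtain ⟨X, h0, hX, hXx⟩ := hx.exists_twoSided
  obtain ⟨w, h⟩ := SturmianRep.exists_chainData h0 hX hXx
  refine ⟨fun k hk => SturmianRep.existsUnique_inCaseWith h0 hX hXx hk,
    SturmianRep.muMin_le_rep h, SturmianRep.rep_le_muMax h, ?_, ?_⟩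
  · rw [← h.eventuallyA_iff, ← SturmianRep.eventuallyB_iff]
    refine ⟨fun hAB => le_antisymm (SturmianRep.rep_le_muMax h) (SturmianRep.muMax_le_rep h hAB),
      fun heq => ?_⟩
    by_contra! hn
    exact (SturmianRep.rep_lt_muMax h hn.1 hn.2).ne heq
  · refine ⟨fun hS => le_antisymm (SturmianRep.rep_le_muMin h hS) (SturmianRep.muMin_le_rep h),
      fun heq d _ => ?_⟩
    by_contra hn
    obtain ⟨hA, hB⟩ := not_or.1 hn
    -- If x is not in `S d`, the positions of chains of length at least d are bounded, so all later
    -- chains of both sorts are shorter than d.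
    obtain ⟨P, hP⟩ := (Set.not_infinite.1 hA).bddAbove
    obtain ⟨Q, hQ⟩ := (Set.not_infinite.1 hB).bddAbove
    refine (SturmianRep.muMin_lt_rep h (d := d) (P := P + Q + 1) (fun p m hp hm => ?_)
      fun p l hp hl => ?_).ne' heq
    · by_contra! hlt
      have : p ≤ P := hP ⟨m, hlt, hm⟩
      omega
    · by_contra! hlt
      have : p ≤ Q := hQ ⟨l, hlt, hl⟩
      omega
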